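/- **Theorem.** Let $\mathbb F_q$ be a finite field with $q$ elements, $a\in\mathbb F_q^*$ an element of multiplicative order $\operatorname{ord}(a)$, and $n$ a positive integer with $\gcd(n,q)=1$. Write $n=n_1n_2$ with $\operatorname{rad}(n_1)\mid\operatorname{ord}(a)$ and $\gcd(n_2,\operatorname{ord}(a))=1$, where $\operatorname{rad}$ denotes the product of the distinct prime divisors. Let $w$ be the multiplicative order of $q$ modulo $\operatorname{rad}(n)$; put $s:=w$ if $4\nmid n$ or $q^w\equiv1\pmod 4$, and $s:=2w$ otherwise. For $t\ge1$ put $$d_1^{(t)}:=\gcd\Bigl(n_1,\frac{q^t-1}{\operatorname{ord}(a)}\Bigr),\qquad d_2^{(t)}:=\gcd(n_2,q^t-1).$$ Put $s_1:=d_1^{(s)}/d_1^{(1)}$ if $4\nmid d_1^{(s)}$ or $q\equiv1\pmod4$, and $s_1:=2d_1^{(s)}/d_1^{(2)}$ otherwise. For a non-negative integer $i$ let $t_i$ be the least positive integer $t$ such that $d_2^{(s)}/d_2^{(t)}$ is an integer dividing $i$, and let $c_i:=\operatorname{lcm}(t_i,s_1)$. Then there is $b\in\mathbb F_{q^s}$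 with $b^{d_1^{(s)}}=a$, and $\mathbb F_{q^s}$ contains primitive $d_1^{(s)}$-th and $d_2^{(s)}$-th roots of unity. Fix any such $b$ and any such primitive roots of unity $\zeta_{d_1^{(s)}},\zeta_{d_2^{(s)}}\in\mathbb F_{q^s}$. On $\{0,\dots,d_1^{(s)}-1\}$ let $j\sim\tilde j$ if and only if $\zeta_{d_1^{(s)}}^{\tilde j}=\zeta_{d_1^{(s)}}^{jq^m}b^{q^m-1}$ for some integer $0\le m\le s_1-1$; this is an equivalence relation. Let $J\subseteq\{0,\dots,d_1^{(s)}-1\}$ be a complete set of representatives of its classes, and let $I\subseteq\{0,\dots,d_2^{(s)}-1\}$ be a complete set of representatives of the $q$-cyclotomic cosets $\{iq^u\bmod d_2^{(s)}:u\ge0\}$ modulo $d_2^{(s)}$. Let $r$ be a positive integer with $r=1$ if $a=1$, and $rn_2\equiv1\pmod{\operatorname{ord}(a)\,d_1^{(s)}}$ if $a\ne1$. Then $$X^n-a=\prod_{j\in J}\ \prod_{v\mid n_2/d_2^{(s)}}\ \prod_{\substack{i\in I\\ \gcd(i,v)=1}}\ \prod_{m=0}^{\gcd(t_i,s_1)-1}S_{(j,v,i,m)},$$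 where, with $\beta:=\zeta_{d_2^{(s)}}^{iq^m}\bigl(\zeta_{d_1^{(s)}}^{j}b\bigr)^{rv}$, $$S_{(j,v,i,m)}=\sum_{l=0}^{c_i}X^{\frac{n_1}{d_1^{(s)}}vl}\,(-1)^{c_i-l}\sum_{\substack{U\subseteq\{0,\dots,c_i-1\}\\|U|=c_i-l}}\ \prod_{u\in U}\beta^{q^u}.$$ For all occurring $(j,v,i,m)$ the polynomial $S_{(j,v,i,m)}$ has coefficients in $\mathbb F_q$, is monic and irreducible over $\mathbb F_q$, has degree $\frac{n_1}{d_1^{(s)}}\,v\,c_i$, and has order $\operatorname{ord}(a)\,n_1\,v\,\frac{d_2^{(s)}}{\gcd(i,d_2^{(s)})}$, where the order of a polynomial $f$ is the least positive integer $e$ with $f\mid X^e-1$. Moreover, $S_{(j,v,i,m)}$ is the $q$-spin of the binomial $h=X^{\frac{n_1}{d_1^{(s)}}v}-\beta$ over $\mathbb F_{q^s}$, that is, $S_{(j,v,i,m)}=\prod_{u=0}^{k-1}h^{(u)}$, where $h^{(u)}$ arises from $h$ by raising all coefficients to the power $q^u$, and $k$ is the degree over $\mathbb F_q$ of the field generated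 by the coefficients of $h$. -/

import Mathlib

open Polynomial

namespace BinomialFactorization

/-- `w = ord_{rad(n)}(q)`, the multiplicative order of `q` modulo the radical of `n`. -/
noncomputable def baseDegree (q n : ℕ) : ℕ :=
  orderOf (q : ZMod (UniqueFactorizationMonoid.radical n))

open Classical in
/-- `s = w` if `4 ∤ n` or `q ^ w ≡ 1 (mod 4)`, and `s = 2 w` otherwise. -/
noncomputable def extDegree (q n : ℕ) : ℕ :=
  if ¬ 4 ∣ n ∨ q ^ baseDegree q n ≡ 1 [MOD 4] then baseDegree q n else 2 * baseDegree q n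

/-- `d₁^{(t)} = gcd(n₁, (q ^ t - 1) / e)`, where `e = ord(a)` divides `q - 1`. -/
def dOne (q e n₁ t : ℕ) : ℕ := Nat.gcd n₁ ((q ^ t - 1) / e)

/-- `d₂^{(t)} = gcd(n₂, q ^ t - 1)`. -/
def dTwo (q n₂ t : ℕ) : ℕ := Nat.gcd n₂ (q ^ t - 1)

open Classical in
/-- `s₁ = d₁^{(s)} / d₁^{(1)}` if `4 ∤ d₁^{(s)}` or `q ≡ 1 (mod 4)`, and
`s₁ = 2 d₁^{(s)} / d₁^{(2)}` otherwise. -/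
noncomputable def sOne (q e n₁ s : ℕ) : ℕ :=
  if ¬ 4 ∣ dOne q e n₁ s ∨ q ≡ 1 [MOD 4] then dOne q e n₁ s / dOne q e n₁ 1
  else 2 * dOne q e n₁ s / dOne q e n₁ 2

/-- `t_i`, the least positive `t` such that `d₂^{(s)} / d₂^{(t)}` is an integer dividing `i`.
(`d₂^{(t)}` need not divide `d₂^{(s)}` for every `t`, so integrality is spelled out.) -/
noncomputable def tMin (q n₂ s i : ℕ) : ℕ :=
  sInf {t : ℕ | 0 < t ∧ dTwo q n₂ t ∣ dTwo q n₂ s ∧ dTwo q n₂ s / dTwo q n₂ t ∣ i}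

/-- `c_i = lcm(t_i, s₁)`. -/
noncomputable def cDegree (q e n₁ n₂ s i : ℕ) : ℕ :=
  Nat.lcm (tMin q n₂ s i) (sOne q e n₁ s)

/-- The `q`-cyclotomic coset modulo `d` containing `i`. -/
def cyclotomicCoset (q d i : ℕ) : Set ℕ := {k | ∃ u : ℕ, k = (i * q ^ u) % d}

/-- `T` contains exactly one representative of every class of the relation `R` on
`{0, …, d - 1}`. -/
def IsRepSystem (R : ℕ → ℕ → Prop) (d : ℕ) (T : Finset ℕ) : Prop :=
  T ⊆ Finset.range d ∧ ∀ j < d, ∃! k, k ∈ T ∧ R j k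

/-- A complete set of representatives of the `q`-cyclotomic cosets modulo `d`. -/
def IsCyclotomicRepSystem (q d : ℕ) (T : Finset ℕ) : Prop :=
  IsRepSystem (fun i k => k ∈ cyclotomicCoset q d i) d T

/-- The relation `j ∼ k` given by `ζ ^ k = ζ ^ (j q ^ m) b ^ (q ^ m - 1)` for some
`0 ≤ m ≤ s₁ - 1`. -/
def FrobRel {L : Type*} [Field L] (q s₁ : ℕ) (ζ b : L) (j k : ℕ) : Prop :=
  ∃ m < s₁, ζ ^ k = ζ ^ (j * q ^ m) * b ^ (q ^ m - 1)

/-- `e` is the order of `f`: the least positive integer with `f ∣ X ^ e - 1`. -/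
def HasOrder {F : Type*} [Field F] (f : F[X]) (e : ℕ) : Prop :=
  IsLeast {k : ℕ | 0 < k ∧ f ∣ X ^ k - 1} e

/-- The degree over `F` of the field generated by the coefficients of `h`. -/
noncomputable def coeffDegree (F : Type*) {L : Type*} [Field F] [Field L] [Algebra F L]
    (h : L[X]) : ℕ :=
  Module.finrank F (IntermediateField.adjoin F (Set.range h.coeff))

/-- `h^{(u)}`: every coefficient of `h` is raised to the power `q ^ u`. -/
noncomputable def frobTwist {L : Type*} [Field L] (q u : ℕ) (h : L[X]) : L[X] :=
  h.sum fun k c => monomial k (c ^ q ^ u)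

/-- The `q`-spin of `h`, where `q` is the number of elements of the finite field `F`. -/
noncomputable def qSpin (F : Type*) {L : Type*} [Field F] [Fintype F] [Field L] [Algebra F L]
    (h : L[X]) : L[X] :=
  ∏ u ∈ Finset.range (coeffDegree F h), frobTwist (Fintype.card F) u h

/-- The polynomial
`∑_{l = 0}^{c} X ^ (N l) (-1) ^ (c - l) ∑_{U ⊆ {0, …, c - 1}, |U| = c - l} ∏_{u ∈ U} β ^ (q ^ u)`. -/
noncomputable def explicitFactor {L : Type*} [Field L] (q N c : ℕ) (β : L) : L[X] :=
  ∑ l ∈ Finset.range (c + 1), X ^ (N * l) *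
    ((-1) ^ (c - l) * C (∑ U ∈ Finset.powersetCard (c - l) (Finset.range c),
      ∏ u ∈ U, β ^ q ^ u))

/-- The constant `ζ₂ ^ (i q ^ m) (ζ₁ ^ j b) ^ (r v)`. -/
def rootConst {L : Type*} [Field L] (q r : ℕ) (ζ₁ ζ₂ b : L) (j v i m : ℕ) : L :=
  ζ₂ ^ (i * q ^ m) * (ζ₁ ^ j * b) ^ (r * v)

end BinomialFactorization

open BinomialFactorization

namespace BinomialFactorization

/-! ### Arithmetic of the numbers `q ^ k - 1` -/

/-! Write `e = ord(a)`, `D₁ = d₁^{(s)}`, `D₂ = d₂^{(s)}`, `L = 𝔽_{q^s}`. If `x ^ n = a`, then `x ^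
(n₁ / D₁)` is an `n₂`-th root of some `g = ζ₁ ^ k b`, which has order `e D₁`. As `r` inverts `n₂`
modulo `e D₁`, `g ^ r` is one such root, and any other differs from it by an `n₂`-th root of unity,
some power `v ∣ n₂ / D₂` of which lies in `L`. So `x` is a root of a binomial `X ^ N - β` over `L`
with `N = (n₁ / D₁) v` (`Params.exists_pow_eq`), and `β` is conjugate over `F` to one of the listed
constants (`Params.exists_eq_rootConst_pow`).

The order of `β` is `M = e D₁ (D₂ / gcd(i, D₂))`, so its degree over `F` is the order of `q` modulo
`M`, namely `c = lcm(t_i, s₁)`. The product of the `c` conjugate binomials has coefficients in `F`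
and degree `N c`. Every prime of `N` divides `M`, so a root `x` has order `N M`; lifting the
exponent (`mul_dvd_pow_sub_one_iff`, `Params.exponent_mul_dvd`) shows that `N M ∣ q ^ d - 1` forces
`N c ∣ d`. Hence the product is the minimal polynomial of `x` (`Params.exists_factor`), which also
gives its order. The definitions of `s` and `s₁` split into cases because lifting the exponent fails
at `2` when the base is `3` modulo `4`.

The factors are pairwise distinct: the order determines `v`, and conjugacy of the constants
determines `j`, `i`, `m` (`Params.eq_of_rootConst_eq`). They therefore have product dividing the
separable `X ^ n - a`, and together they contain all its roots. -/

theorem padicValNat_two_pow_sub_one {Q k : ℕ} (hQ : 1 < Q) (h4 : 4 ∣ Q - 1) (hk : k ≠ 0) :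
    padicValNat 2 (Q ^ k - 1) = padicValNat 2 (Q - 1) + padicValNat 2 k := by
  have h1 : 1 ≤ Q ^ k := Nat.one_le_pow _ _ (by omega)
  have hne : Q ^ k - 1 ≠ 0 := by
    have := Nat.one_lt_pow hk hQ
    omega
  have key := Int.two_pow_sub_pow' (x := (Q : ℤ)) (y := 1) k (by omega) (by omega)
  rw [one_pow] at key
  have e1 : ((Q : ℤ) ^ k - 1) = ((Q ^ k - 1 : ℕ) : ℤ) := by push_cast [h1]; ring
  have e2 : ((Q : ℤ) - 1) = ((Q - 1 : ℕ) : ℤ) := by push_cast [hQ.le]; ring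
  rw [e1, e2] at key
  have h2 : (2 : ℤ) = ((2 : ℕ) : ℤ) := rfl
  rw [h2, Int.natCast_emultiplicity, Int.natCast_emultiplicity, Int.natCast_emultiplicity,
    ← padicValNat_eq_emultiplicity hne, ← padicValNat_eq_emultiplicity (by omega),
    ← padicValNat_eq_emultiplicity hk] at key
  exact_mod_cast key

theorem four_dvd_pow_sub_one_iff {Q k : ℕ} (hQ : Q % 4 = 3) : 4 ∣ Q ^ k - 1 ↔ 2 ∣ k := by
  have h1 : 1 ≤ Q ^ k := Nat.one_le_pow _ _ (by omega)
  rcases Nat.even_or_odd' k with ⟨m, rfl | rfl⟩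
  · have : Q ^ (2 * m) % 4 = 1 := by
      rw [pow_mul, Nat.pow_mod, Nat.pow_mod Q, hQ]
      simp
    omega
  · have : Q ^ (2 * m + 1) % 4 = 3 := by
      rw [pow_succ, Nat.mul_mod, pow_mul, Nat.pow_mod, Nat.pow_mod Q, hQ]
      simp
    omega

/-- If every prime divisor of `N` divides `M ∣ Q - 1`, `N` is prime to `(Q - 1) / M`, and
`Q ≡ 1 (mod 4)` in case `4 ∣ N`, then `Q` has order `N` modulo `N * M`. -/
theorem mul_dvd_pow_sub_one_iff {Q M N : ℕ} (hQ : 1 < Q) (hN : N ≠ 0) (hM : M ∣ Q - 1)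
    (hrad : ∀ p, p.Prime → p ∣ N → p ∣ M) (hcop : Nat.Coprime N ((Q - 1) / M))
    (h4 : 4 ∣ N → 4 ∣ Q - 1) (k : ℕ) : N * M ∣ Q ^ k - 1 ↔ N ∣ k := by
  rcases eq_or_ne k 0 with rfl | hk
  · simp
  have hM0 : M ≠ 0 := by
    rintro rfl
    rw [zero_dvd_iff] at hM
    omega
  have hne : Q ^ k - 1 ≠ 0 := by
    have := Nat.one_lt_pow hk hQ
    omega
  have hMk : M ∣ Q ^ k - 1 := hM.trans (by simpa using Nat.sub_dvd_pow_sub_pow Q 1 k)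
  have key : ∀ p, p.Prime → p ∣ N →
      (padicValNat p N + padicValNat p M ≤ padicValNat p (Q ^ k - 1) ↔
        padicValNat p N ≤ padicValNat p k) := by
    intro p hp hpN
    have : Fact p.Prime := ⟨hp⟩
    have hpQ1 : p ∣ Q - 1 := (hrad p hp hpN).trans hM
    have hpQ : ¬ p ∣ Q := fun h => hp.one_lt.ne' (Nat.dvd_one.1 (by
      have := Nat.dvd_sub h hpQ1
      rwa [Nat.sub_sub_self hQ.le] at this))
    -- Since `N` is prime to `(Q - 1) / M`, the whole `p`-part of `Q - 1` lies in `M`.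
    have hvM : padicValNat p M = padicValNat p (Q - 1) := by
      obtain ⟨R, hR⟩ := hM
      have hR0 : R ≠ 0 := by rintro rfl; omega
      rw [hR, Nat.mul_div_cancel_left _ (Nat.pos_of_ne_zero hM0)] at hcop
      have : ¬ p ∣ R := fun h => hp.one_lt.ne' (Nat.dvd_one.1 (hcop ▸ Nat.dvd_gcd hpN h))
      rw [hR, padicValNat.mul hM0 hR0, padicValNat.eq_zero_of_not_dvd this, add_zero]
    by_cases hgen : p ≠ 2 ∨ 4 ∣ Q - 1
    · have : padicValNat p (Q ^ k - 1) = padicValNat p (Q - 1) + padicValNat p k := by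
        by_cases hp2 : p = 2
        · subst hp2
          exact padicValNat_two_pow_sub_one hQ (by simpa using hgen) hk
        · have := padicValNat.pow_sub_pow (hp.odd_of_ne_two hp2) hQ hpQ1 hpQ hk
          simpa using this
      omega
    -- Here `p = 2` and `Q ≡ 3 (mod 4)`, so `N`, `M` and `Q - 1` all have 2-adic valuation `1`, and
    -- only `4 ∣ Q ^ k - 1 ↔ 2 ∣ k` is left.
    · push Not at hgen
      obtain ⟨rfl, h4Q⟩ := hgen
      have hN4 : ¬ 4 ∣ N := fun h => h4Q (h4 h)
      have v1 : ∀ m, m ≠ 0 → 2 ∣ m → ¬ 4 ∣ m → padicValNat 2 m = 1 := by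
        intro m hm h2 h4
        apply le_antisymm
        · by_contra h
          exact h4 ((padicValNat_dvd_iff_le (p := 2) (n := 2) hm).2 (by omega))
        · exact one_le_padicValNat_of_dvd hm h2
      rw [hvM, v1 N hN hpN hN4, v1 (Q - 1) (by omega) hpQ1 h4Q,
        ← padicValNat_dvd_iff_le hne, ← padicValNat_dvd_iff_le hk]
      have := four_dvd_pow_sub_one_iff (Q := Q) (k := k) (by omega)
      simpa using this
  rw [← Nat.factorization_prime_le_iff_dvd (mul_ne_zero hN hM0) hne,
    ← Nat.factorization_prime_le_iff_dvd hN hk]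
  refine forall₂_congr fun p hp => ?_
  have : Fact p.Prime := ⟨hp⟩
  simp only [Nat.factorization_def _ hp]
  rw [padicValNat.mul hN hM0]
  by_cases hpN : p ∣ N
  · exact key p hp hpN
  · have h2 := (Nat.factorization_prime_le_iff_dvd hM0 hne).2 hMk p hp
    simp only [Nat.factorization_def _ hp] at h2
    simp [padicValNat.eq_zero_of_not_dvd hpN, h2]

theorem dvd_pow_sub_one_iff_orderOf_dvd {q M : ℕ} (hq : 0 < q) (k : ℕ) :
    M ∣ q ^ k - 1 ↔ orderOf (q : ZMod M) ∣ k := by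
  rw [orderOf_dvd_iff_pow_eq_one, ← Nat.modEq_iff_dvd' (Nat.one_le_pow _ _ hq),
    ← ZMod.natCast_eq_natCast_iff]
  push_cast
  exact eq_comm

theorem orderOf_natCast_zmod_pos {q M : ℕ} (h : Nat.Coprime q M) :
    0 < orderOf (q : ZMod M) := by
  rw [← ZMod.coe_unitOfCoprime q h, orderOf_units]
  exact orderOf_pos _

theorem div_gcd_dvd_iff {D i T : ℕ} (hD : D ≠ 0) : D / Nat.gcd i D ∣ T ↔ D ∣ i * T := by
  have hg : 0 < Nat.gcd i D := Nat.gcd_pos_of_pos_right _ (Nat.pos_of_ne_zero hD)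
  obtain ⟨i', hi'⟩ := Nat.gcd_dvd_left i D
  obtain ⟨D', hD'⟩ := Nat.gcd_dvd_right i D
  have hco : Nat.Coprime D' i' := by
    have := Nat.coprime_div_gcd_div_gcd hg
    rw [Nat.div_eq_of_eq_mul_right hg hi', Nat.div_eq_of_eq_mul_right hg hD'] at this
    exact this.symm
  rw [Nat.div_eq_of_eq_mul_right hg hD']
  have hmul : D ∣ i * T ↔ Nat.gcd i D * D' ∣ Nat.gcd i D * (i' * T) := by
    rw [← hD', ← mul_assoc, ← hi']
  rw [hmul, Nat.mul_dvd_mul_iff_left hg]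
  exact hco.dvd_mul_left.symm

theorem pow_sub_one_dvd_pow_sub_one {q k l : ℕ} (h : k ∣ l) : q ^ k - 1 ∣ q ^ l - 1 := by
  obtain ⟨m, rfl⟩ := h
  rw [pow_mul]
  simpa using Nat.sub_dvd_pow_sub_pow (q ^ k) 1 m

theorem dOne_ne_zero {q e n₁ t : ℕ} (hn₁ : n₁ ≠ 0) : dOne q e n₁ t ≠ 0 :=
  Nat.gcd_ne_zero_left hn₁

theorem dTwo_ne_zero {q n₂ t : ℕ} (hn₂ : n₂ ≠ 0) : dTwo q n₂ t ≠ 0 :=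
  Nat.gcd_ne_zero_left hn₂

/-- With `D = d₂^{(s)}`, an integral quotient means `d₂^{(t)} = gcd(q ^ t - 1, D)`. Then `D / gcd(q
^ t - 1, D) ∣ i`, `D ∣ i (q ^ t - 1)` and `D / gcd(i, D) ∣ q ^ t - 1` are equivalent, so the minimum
is an order. -/
theorem tMin_eq_orderOf {q n₂ s i : ℕ} (hq : 0 < q) (hn₂ : n₂ ≠ 0) (hcop : Nat.Coprime n₂ q) :
    tMin q n₂ s i = orderOf (q : ZMod (dTwo q n₂ s / Nat.gcd i (dTwo q n₂ s))) := by
  set D := dTwo q n₂ s with hD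
  have hD0 : D ≠ 0 := dTwo_ne_zero hn₂
  have hM : D / Nat.gcd i D ∣ D := Nat.div_dvd_of_dvd (Nat.gcd_dvd_right _ _)
  have hMq : Nat.Coprime q (D / Nat.gcd i D) :=
    (hcop.coprime_dvd_left (hM.trans (Nat.gcd_dvd_left _ _))).symm
  have ho := orderOf_natCast_zmod_pos hMq
  set o := orderOf (q : ZMod (D / Nat.gcd i D)) with hodef
  have hset : ∀ t, dTwo q n₂ t ∣ D → (D / dTwo q n₂ t ∣ i ↔ o ∣ t) := by
    intro t ht
    have : dTwo q n₂ t = Nat.gcd (q ^ t - 1) D := by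
      apply Nat.dvd_antisymm
      · exact Nat.dvd_gcd (Nat.gcd_dvd_right _ _) ht
      · exact Nat.dvd_gcd ((Nat.gcd_dvd_right _ _).trans (Nat.gcd_dvd_left _ _))
          (Nat.gcd_dvd_left _ _)
    rw [this, div_gcd_dvd_iff hD0, mul_comm, ← div_gcd_dvd_iff hD0,
      dvd_pow_sub_one_iff_orderOf_dvd hq]
  apply IsLeast.csInf_eq
  constructor
  · have hos : o ∣ s :=
      (dvd_pow_sub_one_iff_orderOf_dvd hq s).1 (hM.trans (Nat.gcd_dvd_right _ _))
    have hd : dTwo q n₂ o ∣ D := Nat.gcd_dvd_gcd_of_dvd_right _ (pow_sub_one_dvd_pow_sub_one hos)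
    exact ⟨ho, hd, (hset o hd).2 dvd_rfl⟩
  · rintro t ⟨ht, hd, hi⟩
    exact Nat.le_of_dvd ht ((hset t hd).1 hi)

theorem dvd_pow_sub_one_iff_tMin_dvd {q n₂ s i : ℕ} (hq : 0 < q) (hn₂ : n₂ ≠ 0)
    (hcop : Nat.Coprime n₂ q) (k : ℕ) :
    dTwo q n₂ s / Nat.gcd i (dTwo q n₂ s) ∣ q ^ k - 1 ↔ tMin q n₂ s i ∣ k := by
  rw [tMin_eq_orderOf hq hn₂ hcop, dvd_pow_sub_one_iff_orderOf_dvd hq]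

theorem baseDegree_pos {q n : ℕ} (hcop : Nat.Coprime n q) : 0 < baseDegree q n :=
  orderOf_natCast_zmod_pos
    (hcop.coprime_dvd_left UniqueFactorizationMonoid.radical_dvd_self).symm

theorem extDegree_pos {q n : ℕ} (hcop : Nat.Coprime n q) : 0 < extDegree q n := by
  have := baseDegree_pos hcop
  unfold extDegree
  split_ifs <;> omega

theorem baseDegree_dvd_extDegree {q n : ℕ} : baseDegree q n ∣ extDegree q n := by
  unfold extDegree
  split_ifs
  · exact dvd_rfl
  · exact dvd_mul_left _ _

theorem prime_dvd_pow_extDegree_sub_one {q n p : ℕ} (hq : 0 < q) (hn : n ≠ 0) (hp : p.Prime)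
    (hpn : p ∣ n) : p ∣ q ^ extDegree q n - 1 := by
  have h1 : p ∣ UniqueFactorizationMonoid.radical n :=
    (UniqueFactorizationMonoid.dvd_radical_iff_of_irreducible hp hn).2 hpn
  exact h1.trans ((dvd_pow_sub_one_iff_orderOf_dvd hq _).2 baseDegree_dvd_extDegree)

theorem odd_of_coprime_of_two_dvd {q n : ℕ} (hcop : Nat.Coprime n q) (h : 2 ∣ n) : Odd q :=
  Nat.odd_iff.2 (by
    have := (hcop.coprime_dvd_left h)
    rw [Nat.coprime_two_left] at this
    exact Nat.odd_iff.1 this)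

theorem four_dvd_pow_extDegree_sub_one {q n : ℕ} (hcop : Nat.Coprime n q) (h4 : 4 ∣ n) :
    4 ∣ q ^ extDegree q n - 1 := by
  have hodd := odd_of_coprime_of_two_dvd hcop (dvd_trans (by norm_num) h4)
  have hpos : 0 < q := hodd.pos
  unfold extDegree
  split_ifs with h
  · have h := h.resolve_left (not_not.2 h4)
    exact (Nat.modEq_iff_dvd' (Nat.one_le_pow _ _ hpos)).1 h.symm
  · rw [mul_comm, pow_mul]
    exact dvd_trans (by norm_num) (Nat.eight_dvd_sq_sub_one_of_odd (hodd.pow))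

theorem two_dvd_extDegree {q n : ℕ} (hcop : Nat.Coprime n q) (h4 : 4 ∣ n)
    (hq : ¬ q ≡ 1 [MOD 4]) : 2 ∣ extDegree q n := by
  have hodd := Nat.odd_iff.1 (odd_of_coprime_of_two_dvd hcop (dvd_trans (by norm_num) h4))
  have hq3 : q % 4 = 3 := by
    have : q % 4 ≠ 1 := hq
    omega
  exact (four_dvd_pow_sub_one_iff hq3).1 (four_dvd_pow_extDegree_sub_one hcop h4)

/-- The relation between `d₁^{(u)}` and `d₁^{(s)}` for `u ∣ s`: the order of `q ^ u` modulo
`e d₁^{(s)}` is `d₁^{(s)} / d₁^{(u)}`. -/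
theorem mul_dOne_dvd_pow_sub_one_iff {q e n₁ s u : ℕ} (hq : 1 < q) (hu : 0 < u) (hn₁ : n₁ ≠ 0)
    (he : e ∣ q - 1) (hrad : ∀ p, p.Prime → p ∣ n₁ → p ∣ e) (hus : u ∣ s)
    (h4 : 4 ∣ dOne q e n₁ s → 4 ∣ q ^ u - 1) (k : ℕ) :
    e * dOne q e n₁ s ∣ (q ^ u) ^ k - 1 ↔ dOne q e n₁ s / dOne q e n₁ u ∣ k := by
  have he0 : 0 < e := Nat.pos_of_dvd_of_pos he (by omega)
  have heu : ∀ t, e ∣ q ^ t - 1 := fun t => he.trans (by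
    simpa using pow_sub_one_dvd_pow_sub_one (q := q) (one_dvd t))
  have hdvd : dOne q e n₁ u ∣ dOne q e n₁ s :=
    Nat.gcd_dvd_gcd_of_dvd_right _ (Nat.div_dvd_div (heu u) (pow_sub_one_dvd_pow_sub_one hus))
  obtain ⟨N, hN⟩ := hdvd
  have hd0 : dOne q e n₁ u ≠ 0 := dOne_ne_zero hn₁
  have hs0 : dOne q e n₁ s ≠ 0 := dOne_ne_zero hn₁
  have hN0 : N ≠ 0 := by rintro rfl; exact hs0 (by simpa using hN)
  have hNn : N * dOne q e n₁ u ∣ n₁ := by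
    rw [mul_comm, ← hN]; exact Nat.gcd_dvd_left _ _
  -- Here `N = d₁^{(s)} / d₁^{(u)}` divides `n₁ / d₁^{(u)}`, which is prime to `(q ^ u - 1) / (e
  -- d₁^{(u)})` because `d₁^{(u)}` is the gcd of the two numerators.
  have key := mul_dvd_pow_sub_one_iff (Q := q ^ u) (M := e * dOne q e n₁ u) (N := N)
    (Nat.one_lt_pow hu.ne' hq) hN0
    ((Nat.dvd_div_iff_mul_dvd (heu u)).1 (Nat.gcd_dvd_right _ _))
    (fun p hp hpN => (hrad p hp (hpN.trans ((dvd_mul_right _ _).trans hNn))).trans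
      (dvd_mul_right _ _))
    (by
      rw [← Nat.div_div_eq_div_mul]
      have := Nat.coprime_div_gcd_div_gcd (m := n₁) (n := (q ^ u - 1) / e)
        (Nat.gcd_pos_of_pos_left _ (Nat.pos_of_ne_zero hn₁))
      refine Nat.Coprime.coprime_dvd_left ?_ this
      exact (Nat.dvd_div_iff_mul_dvd (Nat.gcd_dvd_left _ _)).2 (by
        rw [mul_comm]; exact hNn))
    (fun h => h4 (hN ▸ dvd_mul_of_dvd_right h _)) k
  rw [hN, Nat.mul_div_cancel_left _ (Nat.pos_of_ne_zero hd0), ← key]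
  rw [show e * (dOne q e n₁ u * N) = N * (e * dOne q e n₁ u) by ring]

/-- When `4 ∣ d₁^{(s)}` and `q ≡ 3 (mod 4)`, the divisibility forces `k` to be even, so the exponent
is lifted from the base `q ^ 2` instead of `q`. This explains the factor `2` and the `d₁^{(2)}` in
`s₁`. -/
theorem mul_dOne_dvd_pow_sub_one_iff_sOne_dvd {q e n n₁ : ℕ} (hq : 1 < q) (hn₁ : n₁ ≠ 0)
    (hnn : n₁ ∣ n) (hcop : Nat.Coprime n q)
    (he : e ∣ q - 1) (hrad : ∀ p, p.Prime → p ∣ n₁ → p ∣ e) (k : ℕ) :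
    e * dOne q e n₁ (extDegree q n) ∣ q ^ k - 1 ↔ sOne q e n₁ (extDegree q n) ∣ k := by
  unfold sOne
  split_ifs with h
  · have := mul_dOne_dvd_pow_sub_one_iff (s := extDegree q n) hq one_pos hn₁ he hrad (one_dvd _)
      (fun h4 => by
        have h := h.resolve_left (not_not.2 h4)
        simpa using (Nat.modEq_iff_dvd' hq.le).1 h.symm) k
    simpa using this
  · push Not at h
    obtain ⟨h4, hq4⟩ := h
    have h4n : 4 ∣ n := h4.trans ((Nat.gcd_dvd_left _ _).trans hnn)
    have hodd := odd_of_coprime_of_two_dvd hcop (dvd_trans (by norm_num) h4n)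
    have hq3 : q % 4 = 3 := by
      have : q % 4 ≠ 1 := hq4
      have := Nat.odd_iff.1 hodd
      omega
    have h2s := two_dvd_extDegree hcop h4n hq4
    have key := mul_dOne_dvd_pow_sub_one_iff (s := extDegree q n) hq two_pos hn₁ he hrad h2s
      (fun _ => dvd_trans (by norm_num) (Nat.eight_dvd_sq_sub_one_of_odd hodd))
    have heu : ∀ t, e ∣ q ^ t - 1 := fun t => he.trans (by
      simpa using pow_sub_one_dvd_pow_sub_one (q := q) (one_dvd t))
    have hdvd : dOne q e n₁ 2 ∣ dOne q e n₁ (extDegree q n) :=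
      Nat.gcd_dvd_gcd_of_dvd_right _ (Nat.div_dvd_div (heu 2) (pow_sub_one_dvd_pow_sub_one h2s))
    rw [Nat.mul_div_assoc _ hdvd]
    constructor
    · intro hk
      have h2k : 2 ∣ k := (four_dvd_pow_sub_one_iff hq3).1 ((dvd_mul_of_dvd_right h4 e).trans hk)
      obtain ⟨l, rfl⟩ := h2k
      rw [pow_mul] at hk
      exact mul_dvd_mul_left 2 ((key l).1 hk)
    · rintro ⟨l, rfl⟩
      rw [mul_assoc, pow_mul]
      exact (key _).2 (dvd_mul_right _ _)

/-! ### Conjugates and minimal polynomials over finite fields -/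

section FiniteField

variable {F : Type*} [Field F] [Fintype F]

/-- `X ^ q - X` already splits over `F` with root set `F`; evaluating that factorization at `z`
gives a vanishing product. -/
theorem mem_range_algebraMap_of_pow_card_eq {L : Type*} [Field L] [Algebra F L] {z : L}
    (hz : z ^ Fintype.card F = z) : z ∈ Set.range (algebraMap F L) := by
  classical
  have hq := Fintype.one_lt_card (α := F)
  have hprod := prod_multiset_X_sub_C_of_monic_of_roots_card_eq
    (p := (X ^ Fintype.card F - X : F[X]))
    (monic_X_pow_sub (by rw [degree_X]; exact_mod_cast hq))
    (by rw [FiniteField.roots_X_pow_card_sub_X, FiniteField.X_pow_card_sub_X_natDegree_eq F hq]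
        simp)
  rw [FiniteField.roots_X_pow_card_sub_X] at hprod
  have h0 := congrArg (aeval z) hprod
  simp only [map_multiset_prod, Multiset.map_map, map_sub, map_pow, aeval_X, hz, sub_self,
    Multiset.prod_eq_zero_iff, Multiset.mem_map, Function.comp, aeval_C] at h0
  obtain ⟨x, -, hx⟩ := h0
  exact ⟨x, (sub_eq_zero.1 hx).symm⟩

/-- The product of the first `c` Frobenius twists of `X ^ N - β`. -/
noncomputable def twistProd {L : Type*} [Field L] (q N c : ℕ) (β : L) : L[X] :=
  ∏ u ∈ Finset.range c, (X ^ N - C (β ^ q ^ u))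

section TwistProd

variable {L : Type*} [Field L]

theorem twistProd_monic {q N c : ℕ} (hN : N ≠ 0) (β : L) : (twistProd q N c β).Monic :=
  monic_prod_of_monic _ _ fun _ _ => monic_X_pow_sub_C _ hN

theorem natDegree_twistProd {q N c : ℕ} (hN : N ≠ 0) (β : L) :
    (twistProd q N c β).natDegree = N * c := by
  rw [twistProd, natDegree_prod_of_monic _ _ fun _ _ => monic_X_pow_sub_C _ hN]
  simp only [natDegree_X_pow_sub_C, Finset.sum_const, Finset.card_range, smul_eq_mul, mul_comm]

/-- Expanding the product, `U` is the set of factors contributing their constant term; the sum is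
grouped by `|U| = c - l`, whence the reflected index. -/
theorem explicitFactor_eq_twistProd (q N c : ℕ) (β : L) :
    explicitFactor q N c β = twistProd q N c β := by
  classical
  rw [twistProd, Finset.prod_sub, Finset.sum_powerset, explicitFactor, Finset.card_range,
    ← Finset.sum_range_reflect]
  refine Finset.sum_congr rfl fun l hl => ?_
  have hl : l ≤ c := Nat.lt_succ_iff.1 (Finset.mem_range.1 hl)
  have h1 : c + 1 - 1 - l = c - l := by omega
  have h2 : c - (c - l) = l := by omega
  rw [h1, h2, map_sum, Finset.mul_sum, Finset.mul_sum]
  refine Finset.sum_congr rfl fun U hU => ?_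
  obtain ⟨hUs, hUc⟩ := Finset.mem_powersetCard.1 hU
  rw [Finset.prod_const, Finset.card_sdiff_of_subset hUs, Finset.card_range, hUc, map_prod, pow_mul]
  ring

variable [Algebra F L]

/-- Frobenius permutes the factors cyclically, because `β ^ (q ^ c) = β`; so it fixes every
coefficient. -/
theorem exists_map_eq_twistProd {N c : ℕ} {β : L} (hβ : β ^ Fintype.card F ^ c = β) :
    ∃ S : F[X], S.map (algebraMap F L) = twistProd (Fintype.card F) N c β := by
  rw [← mem_lifts, lifts_iff_coeff_lifts]
  intro k
  apply mem_range_algebraMap_of_pow_card_eq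
  have hφ : ∀ x : L, (FiniteField.frobeniusAlgHom F L : L →+* L) x = x ^ Fintype.card F :=
    fun x => by simp
  rw [← hφ, ← coeff_map]
  congr 1
  rw [twistProd, Polynomial.map_prod]
  simp only [Polynomial.map_sub, Polynomial.map_pow, map_X, map_C, hφ, ← pow_mul, ← pow_succ]
  -- The product of `c + 1` factors is split at either end; the end factors agree and can be
  -- cancelled, unless they are zero, which happens only for `N = 0` and `β = 1`.
  have h := Finset.prod_range_succ (fun u => (X ^ N - C (β ^ Fintype.card F ^ u) : L[X])) c
  rw [Finset.prod_range_succ', hβ, pow_zero, pow_one] at h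
  by_cases h0 : (X ^ N - C β : L[X]) = 0
  · have hN : N = 0 := by
      by_contra hN
      exact X_pow_sub_C_ne_zero (Nat.pos_of_ne_zero hN) β h0
    have hβ1 : β = 1 := by
      rw [hN, pow_zero, ← C_1, ← C_sub] at h0
      exact (sub_eq_zero.1 (C_eq_zero.1 h0)).symm
    simp [hβ1]
  · exact mul_right_cancel₀ h0 h

theorem frobTwist_X_pow_sub_C (N u : ℕ) (β : L) :
    frobTwist (Fintype.card F) u (X ^ N - C β) = X ^ N - C (β ^ Fintype.card F ^ u) := by
  have hφ : ∀ x : L, ((FiniteField.frobeniusAlgHom F L : L →+* L) ^ u) x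
      = x ^ Fintype.card F ^ u := by
    induction u with
    | zero => intro x; simp
    | succ u ih =>
      intro x
      rw [pow_succ, RingHom.mul_def, RingHom.comp_apply, ih]
      simp [← pow_mul, pow_succ, mul_comm]
  have : ∀ h : L[X], frobTwist (Fintype.card F) u h
      = h.map ((FiniteField.frobeniusAlgHom F L : L →+* L) ^ u) := by
    intro h
    rw [frobTwist, Polynomial.map, eval₂_eq_sum]
    simp only [RingHom.comp_apply, hφ, C_mul_X_pow_eq_monomial]
  rw [this]
  simp [Polynomial.map_sub, hφ]

end TwistProd

/-- A monic polynomial over `F` of degree `m` with a root all of whose relations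
`x ^ (q ^ d) = x` satisfy `m ∣ d` is the minimal polynomial of this root. -/
theorem eq_minpoly_of_forall_dvd {Ω : Type*} [Field Ω] [Algebra F Ω] {S : F[X]} {x : Ω}
    (hS : S.Monic) (hx : aeval x S = 0)
    (h : ∀ d, x ^ Fintype.card F ^ d = x → S.natDegree ∣ d) : S = minpoly F x := by
  have hint : IsIntegral F x := ⟨S, hS, hx⟩
  have hfr := IntermediateField.adjoin.finrank hint
  have : FiniteDimensional F (IntermediateField.adjoin F {x}) :=
    IntermediateField.adjoin.finiteDimensional hint
  have : Finite (IntermediateField.adjoin F {x}) := Module.finite_of_finite F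
  have := Fintype.ofFinite (IntermediateField.adjoin F {x})
  -- The field `F(x)` has `q ^ deg(minpoly)` elements, so `d = deg(minpoly)` is admissible in `h`.
  have hcard := Module.card_eq_pow_finrank (K := F) (V := IntermediateField.adjoin F {x})
  rw [hfr] at hcard
  have hpow := FiniteField.pow_card (IntermediateField.AdjoinSimple.gen F x)
  rw [hcard] at hpow
  have hpow := congrArg (algebraMap (IntermediateField.adjoin F {x}) Ω) hpow
  rw [map_pow, IntermediateField.AdjoinSimple.algebraMap_gen] at hpow
  exact eq_of_monic_of_dvd_of_natDegree_le (minpoly.monic hint) hS (minpoly.dvd F x hx)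
    (Nat.le_of_dvd (minpoly.natDegree_pos hint) (h _ hpow))

theorem qSpin_X_pow_sub_C_eq_twistProd {L : Type*} [Field L] [Algebra F L] {N c : ℕ} (hN : N ≠ 0)
    (hc : 0 < c) {β : L} (hβ : ∀ d, β ^ Fintype.card F ^ d = β ↔ c ∣ d) :
    qSpin F (X ^ N - C β) = twistProd (Fintype.card F) N c β := by
  have hdeg : coeffDegree F (X ^ N - C β : L[X]) = c := by
    -- For `N = 1` the twisted product is the minimal polynomial of `β`, so `F(β)` has degree `c`.
    obtain ⟨S, hS⟩ := exists_map_eq_twistProd (N := 1) ((hβ c).2 dvd_rfl)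
    have hmonic : S.Monic := by
      have := twistProd_monic (q := Fintype.card F) (c := c) one_ne_zero β
      rw [← hS] at this
      exact monic_of_injective (algebraMap F L).injective this
    have hnat : S.natDegree = c := by
      rw [← natDegree_map (algebraMap F L), hS, natDegree_twistProd one_ne_zero, one_mul]
    have hroot : aeval β S = 0 := by
      rw [aeval_def, ← eval_map, hS, twistProd, eval_prod]
      exact Finset.prod_eq_zero (Finset.mem_range.2 hc) (by simp)
    have hmin := eq_minpoly_of_forall_dvd hmonic hroot (fun d hd => hnat ▸ (hβ d).1 hd)
    have hadj : IntermediateField.adjoin F (Set.range (X ^ N - C β : L[X]).coeff)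
        = IntermediateField.adjoin F {β} := by
      apply le_antisymm
      · rw [IntermediateField.adjoin_le_iff]
        rintro _ ⟨k, rfl⟩
        have hβm := IntermediateField.mem_adjoin_simple_self F β
        simp only [coeff_sub, coeff_X_pow, coeff_C]
        refine sub_mem ?_ ?_
        · split_ifs
          · exact one_mem _
          · exact zero_mem _
        · split_ifs
          · exact hβm
          · exact zero_mem _
      · rw [IntermediateField.adjoin_simple_le_iff]
        have : (X ^ N - C β : L[X]).coeff 0 ∈
            IntermediateField.adjoin F (Set.range (X ^ N - C β : L[X]).coeff) :=
          IntermediateField.subset_adjoin _ _ ⟨0, rfl⟩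
        rw [coeff_sub, coeff_X_pow, coeff_C_zero, if_neg hN.symm, zero_sub] at this
        simpa using neg_mem this
    rw [coeffDegree, hadj, IntermediateField.adjoin.finrank ⟨S, hmonic, hroot⟩, ← hmin, hnat]
  rw [qSpin, hdeg, twistProd]
  exact Finset.prod_congr rfl fun u _ => frobTwist_X_pow_sub_C N u β

theorem pow_card_pow_injective (F : Type*) [Field F] [Fintype F] {L : Type*} [Field L]
    [Algebra F L] (k : ℕ) : Function.Injective fun x : L => x ^ Fintype.card F ^ k := by
  induction k with
  | zero => intro x y h; simpa using h
  | succ k ih =>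
    intro x y h
    simp only [pow_succ, pow_mul] at h
    exact ih ((FiniteField.frobeniusAlgHom F L).injective (by simpa using h))

theorem pow_card_pow_eq_iff_modEq {L : Type*} [Field L] [Algebra F L] {x : L} {τ : ℕ}
    (hx : ∀ d, x ^ Fintype.card F ^ d = x ↔ τ ∣ d) (k l : ℕ) :
    x ^ Fintype.card F ^ k = x ^ Fintype.card F ^ l ↔ k ≡ l [MOD τ] := by
  wlog hkl : k ≤ l generalizing k l
  · rw [eq_comm, this l k (by omega)]
    exact ⟨Nat.ModEq.symm, Nat.ModEq.symm⟩
  obtain ⟨d, rfl⟩ := Nat.exists_eq_add_of_le hkl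
  rw [Nat.modEq_iff_dvd' hkl, Nat.add_sub_cancel_left, ← hx, pow_add, mul_comm, pow_mul]
  exact ⟨fun h => (pow_card_pow_injective F k h).symm, fun h => by rw [h]⟩

/-- Conjugacy under powers of the `q`-Frobenius is symmetric in a finite extension. -/
theorem exists_eq_pow_card_pow {L : Type*} [Field L] [Algebra F L] {s : ℕ}
    (hL : Module.finrank F L = s) (hs : 0 < s) {x y : L} {k l : ℕ}
    (h : x ^ Fintype.card F ^ k = y ^ Fintype.card F ^ l) :
    ∃ m, x = y ^ Fintype.card F ^ m := by
  have : FiniteDimensional F L := FiniteDimensional.of_finrank_pos (hL ▸ hs)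
  have : Finite L := Module.finite_of_finite F
  have := Fintype.ofFinite L
  have hcard := Module.card_eq_pow_finrank (K := F) (V := L)
  rw [hL] at hcard
  have hpow : ∀ m, x ^ Fintype.card F ^ (s * m) = x := fun m => by
    rw [pow_mul, ← hcard, FiniteField.pow_card_pow]
  -- The power `q ^ (s k)` acts as the identity on `L`, so `q ^ (s k - k)` undoes `q ^ k`.
  refine ⟨l + (s * k - k), ?_⟩
  have hk : k ≤ s * k := Nat.le_mul_of_pos_left k hs
  rw [pow_add, pow_mul, ← h, ← pow_mul, ← pow_add, Nat.add_sub_cancel' hk, hpow]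

end FiniteField

/-! ### Orders of roots -/

/-- A prime `p` of `N * orderOf β` already divides `orderOf β`, so removing it from the exponent
leaves a nontrivial power of `β`. -/
theorem orderOf_eq_mul_of_pow_eq {G : Type*} [Monoid G] {x β : G} {N : ℕ} (hN : N ≠ 0)
    (hβ : 0 < orderOf β) (hx : x ^ N = β) (hrad : ∀ p, p.Prime → p ∣ N → p ∣ orderOf β) :
    orderOf x = N * orderOf β := by
  refine orderOf_eq_of_pow_and_pow_div_prime (Nat.mul_pos (Nat.pos_of_ne_zero hN) hβ) ?_ ?_
  · rw [pow_mul, hx, pow_orderOf_eq_one]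
  · intro p hp hpd
    have hpM : p ∣ orderOf β := (hp.dvd_mul.1 hpd).elim (hrad p hp) id
    rw [Nat.mul_div_assoc _ hpM, pow_mul, hx]
    exact pow_ne_one_of_lt_orderOf
      (Nat.div_pos (Nat.le_of_dvd hβ hpM) hp.pos).ne' (Nat.div_lt_self hβ hp.one_lt)

theorem pow_pow_eq_self_iff {G : Type*} [Field G] {x : G} (hx : x ≠ 0) {q : ℕ}
    (hq : 0 < q) (d : ℕ) : x ^ q ^ d = x ↔ orderOf x ∣ q ^ d - 1 := by
  have h1 : q ^ d = q ^ d - 1 + 1 := (Nat.sub_add_cancel (Nat.one_le_pow _ _ hq)).symm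
  rw [orderOf_dvd_iff_pow_eq_one]
  conv_lhs => rw [h1, pow_succ]
  exact ⟨fun h => mul_right_cancel₀ hx (by rw [h, one_mul]), fun h => by rw [h, one_mul]⟩

theorem div_gcd_dvd (i D : ℕ) : D / Nat.gcd i D ∣ D :=
  Nat.div_dvd_of_dvd (Nat.gcd_dvd_right _ _)

theorem coprime_mul_of_prime_dvd {m e D : ℕ} (h : Nat.Coprime m e)
    (hD : ∀ p, p.Prime → p ∣ D → p ∣ e) : Nat.Coprime m (e * D) := by
  refine h.mul_right (Nat.coprime_of_dvd fun p hp h1 h2 => ?_)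
  exact Nat.not_coprime_of_dvd_of_dvd hp.one_lt h1 (hD p hp h2) h

theorem exists_mul_modEq_one {m M : ℕ} (hM : 0 < M) (h : Nat.Coprime m M) :
    ∃ r, r * m ≡ 1 [MOD M] :=
  ⟨m ^ (M.totient - 1), by
    rw [← pow_succ, Nat.sub_add_cancel (Nat.totient_pos.2 hM)]
    exact Nat.ModEq.pow_totient h⟩

/-! ### The numerical parameters of the factorization -/

/-- The arithmetic relations between the parameters `n₁, n₂, D₁ = d₁^{(s)}, D₂ = d₂^{(s)}, s, s₁,
t_i, r` on which the factorization of `X ^ (n₁ n₂) - a`, `e = ord(a)`, rests. -/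
structure Params (q e n₁ n₂ D₁ D₂ s s₁ r : ℕ) (t : ℕ → ℕ) : Prop where
  one_lt_q : 1 < q
  e_ne : e ≠ 0
  n₁_ne : n₁ ≠ 0
  n₂_ne : n₂ ≠ 0
  s_pos : 0 < s
  coprime_q : Nat.Coprime n₂ q
  dvd_e : ∀ p, p.Prime → p ∣ n₁ → p ∣ e
  coprime_e : Nat.Coprime n₂ e
  dvd_D₂ : ∀ p, p.Prime → p ∣ n₂ → p ∣ D₂
  D₁_dvd : D₁ ∣ n₁
  D₂_dvd : D₂ ∣ n₂
  mul_D₁_dvd : e * D₁ ∣ q ^ s - 1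
  D₂_dvd_pow : D₂ ∣ q ^ s - 1
  coprime_D₁ : Nat.Coprime (n₁ / D₁) ((q ^ s - 1) / (e * D₁))
  coprime_D₂ : Nat.Coprime (n₂ / D₂) ((q ^ s - 1) / D₂)
  four_dvd : 4 ∣ n₁ * n₂ → 4 ∣ q ^ s - 1
  dvd_iff_s₁ : ∀ k, e * D₁ ∣ q ^ k - 1 ↔ s₁ ∣ k
  dvd_iff_t : ∀ i k, D₂ / Nat.gcd i D₂ ∣ q ^ k - 1 ↔ t i ∣ k
  r_modEq : r * n₂ ≡ 1 [MOD e * D₁]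

namespace Params

variable {q e n₁ n₂ D₁ D₂ s s₁ r : ℕ} {t : ℕ → ℕ}

theorem D₁_ne (P : Params q e n₁ n₂ D₁ D₂ s s₁ r t)
    : D₁ ≠ 0 := ne_zero_of_dvd_ne_zero P.n₁_ne P.D₁_dvd

theorem D₂_ne (P : Params q e n₁ n₂ D₁ D₂ s s₁ r t)
    : D₂ ≠ 0 := ne_zero_of_dvd_ne_zero P.n₂_ne P.D₂_dvd

theorem s₁_pos (P : Params q e n₁ n₂ D₁ D₂ s s₁ r t) : 0 < s₁ :=
  Nat.pos_of_dvd_of_pos ((P.dvd_iff_s₁ s).1 P.mul_D₁_dvd) P.s_pos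

theorem t_dvd_s (P : Params q e n₁ n₂ D₁ D₂ s s₁ r t) (i : ℕ) : t i ∣ s :=
  (P.dvd_iff_t i s).1 ((div_gcd_dvd i D₂).trans P.D₂_dvd_pow)

theorem t_pos (P : Params q e n₁ n₂ D₁ D₂ s s₁ r t)
    (i : ℕ) : 0 < t i :=
  Nat.pos_of_dvd_of_pos (P.t_dvd_s i) P.s_pos

theorem coprime_mul (P : Params q e n₁ n₂ D₁ D₂ s s₁ r t) : Nat.Coprime n₂ (e * D₁) :=
  coprime_mul_of_prime_dvd P.coprime_e fun p hp h => P.dvd_e p hp (h.trans P.D₁_dvd)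

theorem coprime_mul_D₂ (P : Params q e n₁ n₂ D₁ D₂ s s₁ r t) : Nat.Coprime (e * D₁) D₂ :=
  (P.coprime_mul.coprime_dvd_left P.D₂_dvd).symm

theorem coprime_r (P : Params q e n₁ n₂ D₁ D₂ s s₁ r t) : Nat.Coprime (e * D₁) r := by
  have h := P.r_modEq.gcd_eq
  rw [Nat.gcd_one_left] at h
  exact (Nat.Coprime.coprime_mul_right h).symm

theorem coprime_r_mul (P : Params q e n₁ n₂ D₁ D₂ s s₁ r t)
    {v : ℕ} (hv : v ∣ n₂ / D₂) : Nat.Coprime (e * D₁) (r * v) :=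
  P.coprime_r.mul_right
    (P.coprime_mul.coprime_dvd_left (hv.trans (Nat.div_dvd_of_dvd P.D₂_dvd))).symm

/-- The left modulus is the order of `β`, so the `lcm` is the degree of `β` over `F`. -/
theorem mul_dvd_iff_lcm (P : Params q e n₁ n₂ D₁ D₂ s s₁ r t) (i k : ℕ) :
    e * D₁ * (D₂ / Nat.gcd i D₂) ∣ q ^ k - 1 ↔ Nat.lcm (t i) s₁ ∣ k := by
  rw [Nat.lcm_dvd_iff, ← P.dvd_iff_t, ← P.dvd_iff_s₁]
  have hco := P.coprime_mul_D₂.coprime_dvd_right (div_gcd_dvd i D₂)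
  exact ⟨fun h => ⟨(dvd_mul_left _ _).trans h, (dvd_mul_right _ _).trans h⟩,
    fun h => hco.mul_dvd_of_dvd_of_dvd h.2 h.1⟩

theorem exponent_ne (P : Params q e n₁ n₂ D₁ D₂ s s₁ r t)
    {v : ℕ} (hv : v ∣ n₂ / D₂) : n₁ / D₁ * v ≠ 0 := by
  refine mul_ne_zero ?_ ?_
  · exact (Nat.div_pos (Nat.le_of_dvd (Nat.pos_of_ne_zero P.n₁_ne) P.D₁_dvd)
      (Nat.pos_of_ne_zero P.D₁_ne)).ne'
  · exact ne_zero_of_dvd_ne_zero P.n₂_ne (hv.trans (Nat.div_dvd_of_dvd P.D₂_dvd))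

/-- Every prime of `n₂` divides `D₂`, and `gcd(i, v) = 1` keeps primes of `v` out of `gcd(i, D₂)`.
-/
theorem prime_dvd_div_gcd (P : Params q e n₁ n₂ D₁ D₂ s s₁ r t)
    {v i p : ℕ} (hv : v ∣ n₂ / D₂) (hiv : Nat.Coprime i v) (hp : p.Prime)
    (hpv : p ∣ v) : p ∣ D₂ / Nat.gcd i D₂ := by
  have hpD : p ∣ D₂ := P.dvd_D₂ p hp (hpv.trans (hv.trans (Nat.div_dvd_of_dvd P.D₂_dvd)))
  rw [← Nat.div_mul_cancel (Nat.gcd_dvd_right i D₂)] at hpD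
  refine (hp.dvd_mul.1 hpD).resolve_right fun h => ?_
  exact Nat.not_coprime_of_dvd_of_dvd hp.one_lt (h.trans (Nat.gcd_dvd_left _ _)) hpv hiv

theorem prime_dvd_order (P : Params q e n₁ n₂ D₁ D₂ s s₁ r t)
    {v i p : ℕ} (hv : v ∣ n₂ / D₂) (hiv : Nat.Coprime i v) (hp : p.Prime)
    (hpN : p ∣ n₁ / D₁ * v) : p ∣ e * D₁ * (D₂ / Nat.gcd i D₂) := by
  rcases hp.dvd_mul.1 hpN with h | h
  · rw [mul_assoc]
    exact (P.dvd_e p hp (h.trans (Nat.div_dvd_of_dvd P.D₁_dvd))).trans (dvd_mul_right _ _)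
  · exact (P.prime_dvd_div_gcd hv hiv hp h).trans (dvd_mul_left _ _)

theorem coprime_exponent (P : Params q e n₁ n₂ D₁ D₂ s s₁ r t)
    {v i : ℕ} (hv : v ∣ n₂ / D₂) (hiv : Nat.Coprime i v) :
    Nat.Coprime (n₁ / D₁ * v) ((q ^ s - 1) / (e * D₁ * (D₂ / Nat.gcd i D₂))) := by
  set T := q ^ s - 1
  have hco := P.coprime_mul_D₂.coprime_dvd_right (div_gcd_dvd i D₂)
  have hMT : e * D₁ * (D₂ / Nat.gcd i D₂) ∣ T :=
    hco.mul_dvd_of_dvd_of_dvd P.mul_D₁_dvd ((div_gcd_dvd i D₂).trans P.D₂_dvd_pow)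
  have heD : 0 < e * D₁ := Nat.pos_of_ne_zero (mul_ne_zero P.e_ne P.D₁_ne)
  have hM2 : 0 < D₂ / Nat.gcd i D₂ :=
    Nat.pos_of_ne_zero (ne_zero_of_dvd_ne_zero P.D₂_ne (div_gcd_dvd i D₂))
  obtain ⟨R, hR⟩ := hMT
  rw [hR, Nat.mul_div_cancel_left _ (Nat.mul_pos heD hM2)]
  refine Nat.coprime_of_dvd fun p hp h1 h2 => ?_
  rcases hp.dvd_mul.1 h1 with h | h
  · refine Nat.not_coprime_of_dvd_of_dvd hp.one_lt h ?_ P.coprime_D₁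
    change p ∣ T / (e * D₁)
    rw [hR, mul_assoc, Nat.mul_div_cancel_left _ heD]
    exact h2.trans (dvd_mul_left _ _)
  -- For `p ∣ v`, the cofactor `R` divides `(T / D₂) gcd(i, D₂)`; the first factor is prime to `n₂ /
  -- D₂`, the second to `v`.
  · have hg : T / D₂ * Nat.gcd i D₂ = e * D₁ * R := by
      apply Nat.eq_of_mul_eq_mul_left hM2
      calc D₂ / Nat.gcd i D₂ * (T / D₂ * Nat.gcd i D₂)
          = T / D₂ * (D₂ / Nat.gcd i D₂ * Nat.gcd i D₂) := by ring
        _ = T := by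
          rw [Nat.div_mul_cancel (Nat.gcd_dvd_right i D₂), Nat.div_mul_cancel P.D₂_dvd_pow]
        _ = _ := by rw [hR]; ring
    have hp' : p ∣ T / D₂ * Nat.gcd i D₂ := hg ▸ h2.trans (dvd_mul_left _ _)
    rcases hp.dvd_mul.1 hp' with h3 | h3
    · exact Nat.not_coprime_of_dvd_of_dvd hp.one_lt (h.trans hv) h3 P.coprime_D₂
    · exact Nat.not_coprime_of_dvd_of_dvd hp.one_lt (h3.trans (Nat.gcd_dvd_left _ _)) h hiv

/-- This is the irreducibility criterion: it bounds from below the degree of an element of order `N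
M`. The exponent is first reduced to a multiple of `c`, then lifted from the base `q ^ c`. -/
theorem exponent_mul_dvd (P : Params q e n₁ n₂ D₁ D₂ s s₁ r t)
    {v i d : ℕ} (hv : v ∣ n₂ / D₂) (hiv : Nat.Coprime i v)
    (h : n₁ / D₁ * v * (e * D₁ * (D₂ / Nat.gcd i D₂)) ∣ q ^ d - 1) :
    n₁ / D₁ * v * Nat.lcm (t i) s₁ ∣ d := by
  set M := e * D₁ * (D₂ / Nat.gcd i D₂) with hM
  set N := n₁ / D₁ * v with hN
  set c := Nat.lcm (t i) s₁ with hc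
  have hc0 : c ≠ 0 := Nat.lcm_ne_zero (P.t_pos i).ne' P.s₁_pos.ne'
  obtain ⟨k, rfl⟩ := (P.mul_dvd_iff_lcm i d).1 ((dvd_mul_left _ _).trans h)
  have hMc : M ∣ q ^ c - 1 := (P.mul_dvd_iff_lcm i c).2 dvd_rfl
  have hcs : c ∣ s := Nat.lcm_dvd (P.t_dvd_s i) ((P.dvd_iff_s₁ s).1 P.mul_D₁_dvd)
  have hcop : Nat.Coprime N ((q ^ s - 1) / M) := P.coprime_exponent hv hiv
  have hrad : ∀ p, p.Prime → p ∣ N → p ∣ M := fun p hp => P.prime_dvd_order hv hiv hp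
  have hQ : 1 < q ^ c := Nat.one_lt_pow hc0 P.one_lt_q
  have h4 : 4 ∣ N → 4 ∣ q ^ c - 1 := by
    intro h4N
    have h2M : 2 ∣ M := hrad 2 Nat.prime_two (dvd_trans (by norm_num) h4N)
    have h2Q := h2M.trans hMc
    have hNn : N ∣ n₁ * n₂ := Nat.mul_dvd_mul (Nat.div_dvd_of_dvd P.D₁_dvd)
      (hv.trans (Nat.div_dvd_of_dvd P.D₂_dvd))
    have h4T := P.four_dvd (h4N.trans hNn)
    -- If `q ^ c ≡ 3 (mod 4)`, then `s / c` is even and `8 ∣ q ^ s - 1`. The cofactor of `M` is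
    -- prime to the even `N`, hence odd, so `8 ∣ M ∣ q ^ c - 1`.
    by_contra h4Q
    obtain ⟨l, rfl⟩ := hcs
    have hl : 2 ∣ l := by
      rw [pow_mul] at h4T
      exact (four_dvd_pow_sub_one_iff (by omega)).1 h4T
    have h8 : 8 ∣ q ^ (c * l) - 1 := by
      refine dvd_trans ?_ (pow_sub_one_dvd_pow_sub_one (Nat.mul_dvd_mul_left c hl))
      rw [pow_mul]
      exact Nat.eight_dvd_sq_sub_one_of_odd (Nat.odd_iff.2 (by omega))
    rw [← Nat.div_mul_cancel (hMc.trans (pow_sub_one_dvd_pow_sub_one (dvd_mul_right c l)))] at h8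
    have hco2 : Nat.Coprime 2 ((q ^ (c * l) - 1) / M) :=
      hcop.coprime_dvd_left (dvd_trans (by norm_num) h4N)
    have hco8 : Nat.Coprime 8 ((q ^ (c * l) - 1) / M) := by
      simpa using hco2.pow_left 3
    exact h4Q ((dvd_trans (by norm_num) (hco8.dvd_of_dvd_mul_left h8)).trans hMc)
  have hcop' : Nat.Coprime N ((q ^ c - 1) / M) :=
    hcop.coprime_dvd_right (Nat.div_dvd_div hMc (pow_sub_one_dvd_pow_sub_one hcs))
  rw [pow_mul] at h
  have := (mul_dvd_pow_sub_one_iff hQ (P.exponent_ne hv) hMc hrad hcop' h4 k).1 h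
  rw [mul_comm]
  exact mul_dvd_mul_left c this

end Params

theorem gcd_mul_div_gcd {v i D : ℕ} (hiv : Nat.Coprime i v) :
    Nat.gcd (v * (D / Nat.gcd i D)) D = D / Nat.gcd i D := by
  have hg := Nat.div_mul_cancel (Nat.gcd_dvd_right i D)
  have hco : Nat.Coprime v (Nat.gcd i D) := (hiv.coprime_dvd_left (Nat.gcd_dvd_left _ _)).symm
  calc Nat.gcd (v * (D / Nat.gcd i D)) D
      = Nat.gcd (D / Nat.gcd i D * v) (D / Nat.gcd i D * Nat.gcd i D) := by rw [hg, mul_comm v]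
    _ = D / Nat.gcd i D := by rw [Nat.gcd_mul_left, hco, mul_one]

/-- The exponent `v` is determined by `v D / gcd(i, D)` if `gcd(i, v) = 1`. -/
theorem eq_of_mul_div_gcd_eq {v v' i i' D : ℕ} (hD : D ≠ 0) (hiv : Nat.Coprime i v)
    (hiv' : Nat.Coprime i' v')
    (h : v * (D / Nat.gcd i D) = v' * (D / Nat.gcd i' D)) : v = v' := by
  have h1 := gcd_mul_div_gcd (D := D) hiv
  rw [h, gcd_mul_div_gcd hiv'] at h1
  rw [h1] at h
  exact Nat.eq_of_mul_eq_mul_right (Nat.pos_of_ne_zero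
    (ne_zero_of_dvd_ne_zero hD (div_gcd_dvd _ _))) h

/-! ### Constants of the binomial factors over the extension field -/

theorem eq_one_of_pow_eq_one_of_coprime {G : Type*} [Monoid G] {x : G} {k l : ℕ}
    (h : Nat.Coprime k l) (hk : x ^ k = 1) (hl : x ^ l = 1) : x = 1 := by
  rw [← orderOf_eq_one_iff]
  exact Nat.dvd_one.1 (h ▸ Nat.dvd_gcd (orderOf_dvd_of_pow_eq_one hk)
    (orderOf_dvd_of_pow_eq_one hl))

/-- Two products of torsion elements of coprime exponents agree only if the factors do. -/
theorem eq_and_eq_of_mul_eq_mul {L : Type*} [Field L] {x x' y y' : L} {k l : ℕ} (hk : k ≠ 0)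
    (hl : l ≠ 0) (h : Nat.Coprime k l) (hx : x ^ k = 1) (hx' : x' ^ k = 1) (hy : y ^ l = 1)
    (hy' : y' ^ l = 1) (he : x * y = x' * y') : x = x' ∧ y = y' := by
  have hx0 : x' ≠ 0 := by rintro rfl; simp [zero_pow hk] at hx'
  have hy0 : y ≠ 0 := by rintro rfl; simp [zero_pow hl] at hy
  have hxy : x / x' = y' / y := by
    rw [div_eq_div_iff hx0 hy0, he, mul_comm]
  have h1 : x / x' = 1 := eq_one_of_pow_eq_one_of_coprime h (by rw [div_pow, hx, hx', div_one])
    (by rw [hxy, div_pow, hy, hy', div_one])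
  refine ⟨(div_eq_one_iff_eq hx0).1 h1, ?_⟩
  rw [hxy] at h1
  exact ((div_eq_one_iff_eq hy0).1 h1).symm

theorem eq_of_pow_eq_pow_of_coprime {L : Type*} [Field L] {x y : L} {k l : ℕ} (hk : k ≠ 0)
    (h : Nat.Coprime k l) (hx : x ^ k = 1) (hy : y ^ k = 1) (he : x ^ l = y ^ l) : x = y := by
  have hy0 : y ≠ 0 := by rintro rfl; simp [zero_pow hk] at hy
  refine (div_eq_one_iff_eq hy0).1 (eq_one_of_pow_eq_one_of_coprime h
    (by rw [div_pow, hx, hy, div_one]) ?_)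
  rw [div_pow, he, div_self (pow_ne_zero _ hy0)]

theorem orderOf_pow_of_isPrimitiveRoot {G : Type*} [CommMonoid G] {ζ : G} {D : ℕ} (hD : D ≠ 0)
    (hζ : IsPrimitiveRoot ζ D) (i : ℕ) : orderOf (ζ ^ i) = D / Nat.gcd i D := by
  rcases eq_or_ne i 0 with rfl | hi
  · simp [Nat.div_self (Nat.pos_of_ne_zero hD)]
  · rw [orderOf_pow' ζ hi, ← hζ.eq_orderOf, Nat.gcd_comm]

theorem Params.root_of_unity_pow_pow_eq_self_iff {L : Type*} [Field L] {ζ₂ : L}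
    {q e n₁ n₂ D₁ D₂ s s₁ r : ℕ} {t : ℕ → ℕ} (P : Params q e n₁ n₂ D₁ D₂ s s₁ r t)
    (hζ₂ : IsPrimitiveRoot ζ₂ D₂) (i d : ℕ) : (ζ₂ ^ i) ^ q ^ d = ζ₂ ^ i ↔ t i ∣ d := by
  rw [pow_pow_eq_self_iff (pow_ne_zero _ (hζ₂.ne_zero P.D₂_ne)) (by have := P.one_lt_q; omega),
    orderOf_pow_of_isPrimitiveRoot P.D₂_ne hζ₂, P.dvd_iff_t]

theorem mem_cyclotomicCoset_iff {L : Type*} [Field L] {ζ₂ : L} {q D : ℕ}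
    (hζ₂ : IsPrimitiveRoot ζ₂ D) {i k : ℕ} (hk : k < D) :
    k ∈ cyclotomicCoset q D i ↔ ∃ u, ζ₂ ^ k = (ζ₂ ^ i) ^ q ^ u := by
  refine exists_congr fun u => ?_
  rw [← pow_mul, ← pow_mod_orderOf ζ₂ (i * q ^ u), ← hζ₂.eq_orderOf]
  exact ⟨fun h => by rw [h], fun h => hζ₂.pow_inj hk (Nat.mod_lt _ (by omega)) h⟩

section Constants

variable {F : Type*} [Field F] {L : Type*} [Field L] [Algebra F L]
  {q n₁ n₂ D₁ D₂ s s₁ r : ℕ} {t : ℕ → ℕ} {a : F} {b ζ₁ ζ₂ : L}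

theorem pow_mul_root_pow (hb : b ^ D₁ = algebraMap F L a) (hζ₁ : IsPrimitiveRoot ζ₁ D₁) (j : ℕ) :
    (ζ₁ ^ j * b) ^ D₁ = algebraMap F L a := by
  rw [mul_pow, ← pow_mul, mul_comm j, pow_mul, hζ₁.pow_eq_one, one_pow, one_mul, hb]

theorem orderOf_algebraMap (L : Type*) [Field L] [Algebra F L] (a : F) :
    orderOf (algebraMap F L a) = orderOf a :=
  orderOf_injective (algebraMap F L).toMonoidHom (algebraMap F L).injective a

theorem Params.orderOf_root (P : Params q (orderOf a) n₁ n₂ D₁ D₂ s s₁ r t)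
    (hb : b ^ D₁ = algebraMap F L a) (hζ₁ : IsPrimitiveRoot ζ₁ D₁) (j : ℕ) :
    orderOf (ζ₁ ^ j * b) = orderOf a * D₁ := by
  have h := orderOf_eq_mul_of_pow_eq P.D₁_ne
    (by rw [orderOf_algebraMap L a]; exact Nat.pos_of_ne_zero P.e_ne) (pow_mul_root_pow hb hζ₁ j)
    (fun p hp hpD => by
      rw [orderOf_algebraMap L a]; exact P.dvd_e p hp (hpD.trans P.D₁_dvd))
  rw [h, orderOf_algebraMap, mul_comm]

theorem Params.root_pow (P : Params q (orderOf a) n₁ n₂ D₁ D₂ s s₁ r t)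
    (hb : b ^ D₁ = algebraMap F L a) (hζ₁ : IsPrimitiveRoot ζ₁ D₁) (j : ℕ) :
    (ζ₁ ^ j * b) ^ (orderOf a * D₁) = 1 := by
  rw [← P.orderOf_root hb hζ₁ j, pow_orderOf_eq_one]

theorem Params.root_ne_zero (P : Params q (orderOf a) n₁ n₂ D₁ D₂ s s₁ r t)
    (hb : b ^ D₁ = algebraMap F L a) (hζ₁ : IsPrimitiveRoot ζ₁ D₁) (j : ℕ) :
    ζ₁ ^ j * b ≠ 0 := by
  intro h
  have := P.root_pow hb hζ₁ j
  rw [h, zero_pow (mul_ne_zero P.e_ne P.D₁_ne)] at this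
  exact zero_ne_one this

theorem Params.root_pow_pow_eq_self_iff (P : Params q (orderOf a) n₁ n₂ D₁ D₂ s s₁ r t)
    (hb : b ^ D₁ = algebraMap F L a) (hζ₁ : IsPrimitiveRoot ζ₁ D₁) (j d : ℕ) :
    (ζ₁ ^ j * b) ^ q ^ d = ζ₁ ^ j * b ↔ s₁ ∣ d := by
  rw [pow_pow_eq_self_iff (P.root_ne_zero hb hζ₁ j) (by have := P.one_lt_q; omega),
    P.orderOf_root hb hζ₁, P.dvd_iff_s₁]

/-- The exponents `q ^ m` and `r v` are prime to the orders of the elements they act on, and the two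
resulting orders are coprime. -/
theorem Params.orderOf_rootConst (P : Params q (orderOf a) n₁ n₂ D₁ D₂ s s₁ r t)
    (hb : b ^ D₁ = algebraMap F L a) (hζ₁ : IsPrimitiveRoot ζ₁ D₁) (hζ₂ : IsPrimitiveRoot ζ₂ D₂)
    {v : ℕ} (hv : v ∣ n₂ / D₂) (j i m : ℕ) :
    orderOf (rootConst q r ζ₁ ζ₂ b j v i m) = orderOf a * D₁ * (D₂ / Nat.gcd i D₂) := by
  have h1 : orderOf ((ζ₁ ^ j * b) ^ (r * v)) = orderOf a * D₁ := by
    rw [Nat.Coprime.orderOf_pow, P.orderOf_root hb hζ₁]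
    rw [P.orderOf_root hb hζ₁]
    exact P.coprime_r_mul hv
  have h2 : orderOf (ζ₂ ^ (i * q ^ m)) = D₂ / Nat.gcd i D₂ := by
    rw [orderOf_pow_of_isPrimitiveRoot P.D₂_ne hζ₂, Nat.Coprime.gcd_mul_right_cancel]
    exact ((P.coprime_q.coprime_dvd_left P.D₂_dvd).pow_right m).symm
  rw [rootConst, mul_comm, (Commute.all _ _).orderOf_mul_eq_mul_orderOf_of_coprime, h1, h2]
  rw [h1, h2]
  exact P.coprime_mul_D₂.coprime_dvd_right (div_gcd_dvd i D₂)

theorem Params.rootConst_ne_zero (P : Params q (orderOf a) n₁ n₂ D₁ D₂ s s₁ r t)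
    (hb : b ^ D₁ = algebraMap F L a) (hζ₁ : IsPrimitiveRoot ζ₁ D₁) (hζ₂ : IsPrimitiveRoot ζ₂ D₂)
    (j v i m : ℕ) : rootConst q r ζ₁ ζ₂ b j v i m ≠ 0 :=
  mul_ne_zero (pow_ne_zero _ (hζ₂.ne_zero P.D₂_ne)) (pow_ne_zero _ (P.root_ne_zero hb hζ₁ j))

theorem Params.rootConst_pow_pow_eq_self_iff (P : Params q (orderOf a) n₁ n₂ D₁ D₂ s s₁ r t)
    (hb : b ^ D₁ = algebraMap F L a) (hζ₁ : IsPrimitiveRoot ζ₁ D₁) (hζ₂ : IsPrimitiveRoot ζ₂ D₂)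
    {v : ℕ} (hv : v ∣ n₂ / D₂) (j i m d : ℕ) :
    rootConst q r ζ₁ ζ₂ b j v i m ^ q ^ d = rootConst q r ζ₁ ζ₂ b j v i m ↔
      Nat.lcm (t i) s₁ ∣ d := by
  rw [pow_pow_eq_self_iff (P.rootConst_ne_zero hb hζ₁ hζ₂ j v i m)
    (by have := P.one_lt_q; omega), P.orderOf_rootConst hb hζ₁ hζ₂ hv, P.mul_dvd_iff_lcm]

/-- `∼` is conjugacy of the `D₁`-th roots `ζ₁ ^ j b` of `a`. -/
theorem Params.frobRel_iff (P : Params q (orderOf a) n₁ n₂ D₁ D₂ s s₁ r t)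
    [Fintype F] (hq : Fintype.card F = q)
    (hb : b ^ D₁ = algebraMap F L a) (hζ₁ : IsPrimitiveRoot ζ₁ D₁) (j k : ℕ) :
    FrobRel q s₁ ζ₁ b j k ↔ ∃ m, ζ₁ ^ k * b = (ζ₁ ^ j * b) ^ q ^ m := by
  have hb0 : b ≠ 0 := fun h => P.root_ne_zero hb hζ₁ 0 (by simp [h])
  have key : ∀ m, ζ₁ ^ k = ζ₁ ^ (j * q ^ m) * b ^ (q ^ m - 1) ↔
      ζ₁ ^ k * b = (ζ₁ ^ j * b) ^ q ^ m := by
    intro m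
    have h1 : q ^ m - 1 + 1 = q ^ m :=
      Nat.sub_add_cancel (Nat.one_le_pow _ _ (by have := P.one_lt_q; omega))
    rw [mul_pow, ← pow_mul]
    conv_rhs => rw [← h1, pow_succ b, h1, ← mul_assoc]
    exact (mul_left_inj' hb0).symm
  constructor
  · rintro ⟨m, -, hm⟩
    exact ⟨m, (key m).1 hm⟩
  · rintro ⟨m, hm⟩
    -- The `q ^ s₁`-power map fixes `ζ₁ ^ j b`, so `m` matters only modulo `s₁`.
    refine ⟨m % s₁, Nat.mod_lt _ P.s₁_pos, (key _).2 ?_⟩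
    rw [hm]
    subst hq
    exact (pow_card_pow_eq_iff_modEq (F := F) (P.root_pow_pow_eq_self_iff hb hζ₁ j) _ _).2
      (Nat.mod_modEq _ _).symm

theorem Params.equivalence_frobRel (P : Params q (orderOf a) n₁ n₂ D₁ D₂ s s₁ r t)
    [Fintype F] (hq : Fintype.card F = q) (hL : Module.finrank F L = s)
    (hb : b ^ D₁ = algebraMap F L a) (hζ₁ : IsPrimitiveRoot ζ₁ D₁) :
    Equivalence (fun j k : Fin D₁ => FrobRel q s₁ ζ₁ b j k) where
  refl j := (P.frobRel_iff hq hb hζ₁ j j).2 ⟨0, by simp⟩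
  symm {j k} h := by
    obtain ⟨m, hm⟩ := (P.frobRel_iff hq hb hζ₁ j k).1 h
    subst hq
    exact (P.frobRel_iff rfl hb hζ₁ k j).2
      (exists_eq_pow_card_pow (F := F) hL P.s_pos (k := m) (l := 0) (by rw [← hm]; simp))
  trans {j k l} h h' := by
    obtain ⟨m, hm⟩ := (P.frobRel_iff hq hb hζ₁ j k).1 h
    obtain ⟨m', hm'⟩ := (P.frobRel_iff hq hb hζ₁ k l).1 h'
    exact (P.frobRel_iff hq hb hζ₁ j l).2 ⟨m + m', by rw [hm', hm, ← pow_mul, ← pow_add]⟩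

end Constants

/-! ### Single factors -/

theorem twistProd_eq_expand {L : Type*} [Field L] (q N c : ℕ) (β : L) :
    twistProd q N c β = expand L N (twistProd q 1 c β) := by
  simp [twistProd, map_prod]

/-- Replacing `X ^ N` by `X` makes `β` itself a root of both products. -/
theorem exists_eq_pow_of_twistProd_eq {L : Type*} [Field L] {q N c c' : ℕ} {β β' : L}
    (hN : N ≠ 0) (hc : 0 < c) (h : twistProd q N c β = twistProd q N c' β') :
    ∃ u, β = β' ^ q ^ u := by
  rw [twistProd_eq_expand q N c, twistProd_eq_expand q N c'] at h
  have h0 := congrArg (eval β) (expand_injective (Nat.pos_of_ne_zero hN) h)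
  have hβ : eval β (twistProd q 1 c β) = 0 := by
    rw [twistProd, eval_prod]
    exact Finset.prod_eq_zero (Finset.mem_range.2 hc) (by simp)
  rw [hβ, twistProd, eval_prod, eq_comm, Finset.prod_eq_zero_iff] at h0
  obtain ⟨u, -, hu⟩ := h0
  exact ⟨u, sub_eq_zero.1 (by simpa using hu)⟩

section Factors

variable {F : Type*} [Field F] {L : Type*} [Field L] [Algebra F L]
  {q n₁ n₂ D₁ D₂ s s₁ r : ℕ} {t : ℕ → ℕ} {a : F} {b ζ₁ ζ₂ : L}

theorem hasOrder_minpoly {F Ω : Type*} [Field F] [Field Ω] [Algebra F Ω] {x : Ω}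
    (hx : 0 < orderOf x) : HasOrder (minpoly F x) (orderOf x) := by
  have key : ∀ k, minpoly F x ∣ X ^ k - 1 ↔ orderOf x ∣ k := fun k => by
    rw [minpoly.dvd_iff, orderOf_dvd_iff_pow_eq_one]
    simp [sub_eq_zero]
  exact ⟨⟨hx, (key _).2 dvd_rfl⟩, fun k hk => Nat.le_of_dvd hk.1 ((key k).1 hk.2)⟩

theorem Params.pow_r_mul {G : Type*} [Monoid G] {q e n₁ n₂ D₁ D₂ s s₁ r : ℕ} {t : ℕ → ℕ}
    (P : Params q e n₁ n₂ D₁ D₂ s s₁ r t) {x : G} (hx : x ^ (e * D₁) = 1) : x ^ (r * n₂) = x := by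
  have h := pow_eq_pow_of_modEq P.r_modEq hx
  rwa [pow_one] at h

theorem Params.exists_factor (P : Params q (orderOf a) n₁ n₂ D₁ D₂ s s₁ r t)
    [Fintype F] (hq : Fintype.card F = q) (hb : b ^ D₁ = algebraMap F L a)
    (hζ₁ : IsPrimitiveRoot ζ₁ D₁) (hζ₂ : IsPrimitiveRoot ζ₂ D₂) {j v i m : ℕ}
    (hv : v ∣ n₂ / D₂) (hiv : Nat.Coprime i v) :
    ∃ S : F[X], S.map (algebraMap F L) =
        twistProd q (n₁ / D₁ * v) (Nat.lcm (t i) s₁) (rootConst q r ζ₁ ζ₂ b j v i m) ∧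
      S.Monic ∧ Irreducible S ∧ S.natDegree = n₁ / D₁ * v * Nat.lcm (t i) s₁ ∧
      HasOrder S (orderOf a * n₁ * v * (D₂ / Nat.gcd i D₂)) ∧ S ∣ X ^ (n₁ * n₂) - C a := by
  subst hq
  set q := Fintype.card F
  set N := n₁ / D₁ * v with hN
  set β := rootConst q r ζ₁ ζ₂ b j v i m with hβ
  have hN0 : N ≠ 0 := P.exponent_ne hv
  have hc : 0 < Nat.lcm (t i) s₁ := Nat.lcm_pos (P.t_pos i) P.s₁_pos
  have hself := P.rootConst_pow_pow_eq_self_iff hb hζ₁ hζ₂ hv j i m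
  have hord : orderOf β = _ := P.orderOf_rootConst hb hζ₁ hζ₂ hv j i m
  have hordpos : 0 < orderOf β := by
    rw [hord]
    exact Nat.pos_of_ne_zero (mul_ne_zero (mul_ne_zero P.e_ne P.D₁_ne)
      (ne_zero_of_dvd_ne_zero P.D₂_ne (div_gcd_dvd i D₂)))
  obtain ⟨S, hS⟩ := exists_map_eq_twistProd (F := F) (N := N) ((hself _).2 dvd_rfl)
  have hmonic : S.Monic := by
    have := twistProd_monic (q := q) (c := Nat.lcm (t i) s₁) hN0 β
    rw [← hS] at this
    exact monic_of_injective (algebraMap F L).injective this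
  have hnat : S.natDegree = N * Nat.lcm (t i) s₁ := by
    rw [← natDegree_map (algebraMap F L), hS, natDegree_twistProd hN0]
  -- One root `x` suffices: irreducibility, order and divisibility all follow from `S` being its
  -- minimal polynomial.
  obtain ⟨x, hx⟩ := IsAlgClosed.exists_pow_nat_eq (algebraMap L (AlgebraicClosure L) β)
    (Nat.pos_of_ne_zero hN0)
  have hordx : orderOf x = N * orderOf β := by
    rw [← orderOf_algebraMap (AlgebraicClosure L) β]
    refine orderOf_eq_mul_of_pow_eq hN0 (by rwa [orderOf_algebraMap]) hx fun p hp hpN => ?_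
    rw [orderOf_algebraMap, hord]
    exact P.prime_dvd_order hv hiv hp hpN
  have hordxpos : 0 < orderOf x := hordx ▸ Nat.mul_pos (Nat.pos_of_ne_zero hN0) hordpos
  have hx0 : x ≠ 0 := by
    rintro rfl
    rw [zero_pow hN0, eq_comm, map_eq_zero] at hx
    exact P.rootConst_ne_zero hb hζ₁ hζ₂ j v i m hx
  have hroot : aeval x S = 0 := by
    rw [← aeval_map_algebraMap L, hS, twistProd, map_prod]
    exact Finset.prod_eq_zero (Finset.mem_range.2 hc) (by simp [hx, β])
  have hmin : S = minpoly F x := by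
    refine eq_minpoly_of_forall_dvd hmonic hroot fun d hd => ?_
    rw [pow_pow_eq_self_iff hx0 (by have := P.one_lt_q; omega), hordx, hord] at hd
    rw [hnat]
    exact P.exponent_mul_dvd hv hiv hd
  have hD₁ := Nat.div_mul_cancel P.D₁_dvd
  refine ⟨S, hS, hmonic, ?_, hnat, ?_, ?_⟩
  · rw [hmin]
    exact minpoly.irreducible ⟨S, hmonic, hroot⟩
  · have : orderOf a * n₁ * v * (D₂ / Nat.gcd i D₂) = orderOf x := by
      rw [hordx, hord, hN]
      calc _ = orderOf a * (n₁ / D₁ * D₁) * v * (D₂ / Nat.gcd i D₂) := by rw [hD₁]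
        _ = _ := by ring
    rw [this, hmin]
    exact hasOrder_minpoly hordxpos
  · rw [hmin, minpoly.dvd_iff]
    obtain ⟨w, hw⟩ := hv
    have hn₂ : n₂ = v * D₂ * w := by
      rw [← Nat.div_mul_cancel P.D₂_dvd, hw]; ring
    have hexp : n₁ * n₂ = N * (D₁ * D₂ * w) := by
      calc n₁ * n₂ = n₁ / D₁ * D₁ * (v * D₂ * w) := by rw [hD₁, ← hn₂]
        _ = _ := by rw [hN]; ring
    -- The factor `D₂` kills the `ζ₂`-part, and `v D₂ w = n₂` is cancelled by `r`, leaving `(ζ₁ ^ j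
    -- b) ^ D₁ = a`.
    have hβpow : β ^ (D₁ * D₂ * w) = algebraMap F L a := by
      rw [hβ, rootConst, mul_pow, ← pow_mul, ← pow_mul,
        show i * q ^ m * (D₁ * D₂ * w) = D₂ * (i * q ^ m * D₁ * w) by ring, pow_mul,
        hζ₂.pow_eq_one, one_pow, one_mul,
        show r * v * (D₁ * D₂ * w) = r * (v * D₂ * w) * D₁ by ring, ← hn₂, pow_mul,
        P.pow_r_mul (P.root_pow hb hζ₁ j), pow_mul_root_pow hb hζ₁]
    simp only [map_sub, map_pow, aeval_X, aeval_C]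
    rw [hexp, pow_mul, hx, ← map_pow, hβpow, ← IsScalarTower.algebraMap_apply, sub_self]

theorem IsRepSystem.eq_of_rel {R : ℕ → ℕ → Prop} {d : ℕ} {T : Finset ℕ} (hT : IsRepSystem R d T)
    {j k : ℕ} (hj : j ∈ T) (hk : k ∈ T) (hjj : R j j) (hjk : R j k) : j = k :=
  (hT.2 j (Finset.mem_range.1 (hT.1 hj))).unique ⟨hj, hjj⟩ ⟨hk, hjk⟩

/-- The equation splits into its `D₂`- and `e D₁`-torsion parts. The latter yields `j = j'` and `s₁
∣ u`; the former yields `i = i'` and `m ≡ m' + u` modulo `t_i`. Modulo `gcd(t_i, s₁)` the shift `u`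
disappears. -/
theorem Params.eq_of_rootConst_eq (P : Params q (orderOf a) n₁ n₂ D₁ D₂ s s₁ r t)
    [Fintype F] (hq : Fintype.card F = q) (hL : Module.finrank F L = s)
    (hb : b ^ D₁ = algebraMap F L a) (hζ₁ : IsPrimitiveRoot ζ₁ D₁)
    (hζ₂ : IsPrimitiveRoot ζ₂ D₂) {J I : Finset ℕ}
    (hJ : IsRepSystem (FrobRel q s₁ ζ₁ b) D₁ J) (hI : IsCyclotomicRepSystem q D₂ I)
    {j j' v i i' m m' u : ℕ} (hv : v ∣ n₂ / D₂) (hj : j ∈ J) (hj' : j' ∈ J) (hi : i ∈ I)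
    (hi' : i' ∈ I) (hm : m < Nat.gcd (t i) s₁) (hm' : m' < Nat.gcd (t i') s₁)
    (h : rootConst q r ζ₁ ζ₂ b j v i m = rootConst q r ζ₁ ζ₂ b j' v i' m' ^ q ^ u) :
    j = j' ∧ i = i' ∧ m = m' := by
  have htor : ∀ k l, ((ζ₁ ^ k * b) ^ l) ^ (orderOf a * D₁) = 1 := fun k l => by
    rw [← pow_mul, mul_comm l, pow_mul, P.root_pow hb hζ₁, one_pow]
  have htor₂ : ∀ k, (ζ₂ ^ k) ^ D₂ = 1 := fun k => by
    rw [← pow_mul, mul_comm, pow_mul, hζ₂.pow_eq_one, one_pow]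
  have heD := mul_ne_zero P.e_ne P.D₁_ne
  rw [rootConst, rootConst, mul_pow (ζ₂ ^ (i' * q ^ m')), ← pow_mul, ← pow_mul] at h
  obtain ⟨h2, h1⟩ := eq_and_eq_of_mul_eq_mul P.D₂_ne heD
    P.coprime_mul_D₂.symm (htor₂ _) (htor₂ _) (htor _ _) (htor _ _) h
  rw [mul_comm (r * v), pow_mul _ (q ^ u)] at h1
  have h1 := eq_of_pow_eq_pow_of_coprime heD (P.coprime_r_mul hv) (P.root_pow hb hζ₁ j)
    (htor j' _) h1
  have hjj : j' = j := hJ.eq_of_rel hj' hj ((P.frobRel_iff hq hb hζ₁ _ _).2 ⟨0, by simp⟩)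
    ((P.frobRel_iff hq hb hζ₁ _ _).2 ⟨u, h1⟩)
  subst hjj
  have hu : s₁ ∣ u := (P.root_pow_pow_eq_self_iff hb hζ₁ j' u).1 h1.symm
  rw [mul_assoc, pow_mul, pow_mul, ← pow_add] at h2
  have hiD := Finset.mem_range.1 (hI.1 hi)
  have hiD' := Finset.mem_range.1 (hI.1 hi')
  subst hq
  have hii : i' = i := hI.eq_of_rel hi' hi ((mem_cyclotomicCoset_iff hζ₂ hiD').2 ⟨0, by simp⟩)
    ((mem_cyclotomicCoset_iff hζ₂ hiD).2 (exists_eq_pow_card_pow (F := F) hL P.s_pos h2))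
  subst hii
  have hmod := (pow_card_pow_eq_iff_modEq (F := F)
    (P.root_of_unity_pow_pow_eq_self_iff hζ₂ i') _ _).1 h2
  refine ⟨rfl, rfl, Nat.ModEq.eq_of_lt_of_lt ?_ hm hm'⟩
  refine (hmod.of_dvd (Nat.gcd_dvd_left _ _)).trans ?_
  have : u ≡ 0 [MOD Nat.gcd (t i') s₁] :=
    Nat.modEq_zero_iff_dvd.2 ((Nat.gcd_dvd_right _ _).trans hu)
  simpa using this.add_left m'

/-- A common prime `p` of `l` and `v` would make `gcd(f, D₂) p` a common divisor of `f` and `D₂`. -/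
theorem Params.coprime_of_gcd_eq {e : ℕ} (P : Params q e n₁ n₂ D₁ D₂ s s₁ r t) {f v l : ℕ}
    (hf : f = Nat.gcd f D₂ * v) (hvn : v ∣ n₂ / D₂) (hl : D₂ / Nat.gcd l D₂ = Nat.gcd f D₂) :
    Nat.Coprime l v := by
  refine Nat.coprime_of_dvd fun p hp hpl hpv => ?_
  have hpD : p ∣ D₂ := P.dvd_D₂ p hp (hpv.trans (hvn.trans (Nat.div_dvd_of_dvd P.D₂_dvd)))
  have h1 : Nat.gcd f D₂ * p ∣ f := (Nat.mul_dvd_mul_left _ hpv).trans (dvd_of_eq hf.symm)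
  have h2 : Nat.gcd f D₂ * p ∣ D₂ := by
    refine (Nat.mul_dvd_mul_left _ (Nat.dvd_gcd hpl hpD)).trans (dvd_of_eq ?_)
    rw [← hl, Nat.div_mul_cancel (Nat.gcd_dvd_right _ _)]
  have hpos : 0 < Nat.gcd f D₂ :=
    Nat.gcd_pos_of_pos_right _ (Nat.pos_of_ne_zero P.D₂_ne)
  have h3 := Nat.le_of_dvd hpos (Nat.dvd_gcd h1 h2)
  have := hp.two_le
  nlinarith

/-- Every root of `X ^ (n₁ n₂) - a` is a root of a binomial over the extension field. -/
theorem Params.exists_pow_eq (P : Params q (orderOf a) n₁ n₂ D₁ D₂ s s₁ r t)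
    (hb : b ^ D₁ = algebraMap F L a) (hζ₁ : IsPrimitiveRoot ζ₁ D₁)
    (hζ₂ : IsPrimitiveRoot ζ₂ D₂)
    {Ω : Type*} [Field Ω] [Algebra L Ω] [Algebra F Ω] [IsScalarTower F L Ω]
    {x : Ω} (hx : x ^ (n₁ * n₂) = algebraMap F Ω a) :
    ∃ k < D₁, ∃ v, v ∣ n₂ / D₂ ∧ ∃ l < D₂, Nat.Coprime l v ∧
      x ^ (n₁ / D₁ * v) = algebraMap L Ω (ζ₂ ^ l * (ζ₁ ^ k * b) ^ (r * v)) := by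
  set ι := algebraMap L Ω with hι
  have hinj : Function.Injective ι := ι.injective
  have : NeZero D₁ := ⟨P.D₁_ne⟩
  have : NeZero D₂ := ⟨P.D₂_ne⟩
  have hD₁ := Nat.div_mul_cancel P.D₁_dvd
  have hb0 : b ≠ 0 := fun h => P.root_ne_zero hb hζ₁ 0 (by simp [h])
  set y := x ^ (n₁ / D₁) with hy
  obtain ⟨k, hkD, hk⟩ : ∃ k < D₁, ι ζ₁ ^ k = y ^ n₂ / ι b := by
    apply (hζ₁.map_of_injective hinj).eq_pow_of_pow_eq_one
    rw [div_pow, ← map_pow, hb, ← IsScalarTower.algebraMap_apply, ← hx, hy, ← pow_mul, ← pow_mul,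
      show n₁ / D₁ * (n₂ * D₁) = n₁ / D₁ * D₁ * n₂ by ring, hD₁, div_self]
    rw [hx, IsScalarTower.algebraMap_apply F L Ω, ← hb, map_pow]
    exact pow_ne_zero _ ((map_ne_zero ι).2 hb0)
  have hyk : y ^ n₂ = ι (ζ₁ ^ k * b) := by
    rw [map_mul, map_pow, hk, div_mul_cancel₀ _ ((map_ne_zero ι).2 hb0)]
  set g := ζ₁ ^ k * b with hg
  have hg0 : g ≠ 0 := P.root_ne_zero hb hζ₁ k
  -- Since `(g ^ r) ^ n₂ = g = y ^ n₂` in the closure, `z` is an `n₂`-th root of unity.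
  set z := y / ι (g ^ r) with hz
  have hz0 : ι (g ^ r) ≠ 0 := (map_ne_zero ι).2 (pow_ne_zero _ hg0)
  have hzn : z ^ n₂ = 1 := by
    rw [hz, div_pow, hyk, ← map_pow, ← pow_mul, P.pow_r_mul (P.root_pow hb hζ₁ k), div_self]
    exact (map_ne_zero ι).2 hg0
  have hfn : orderOf z ∣ n₂ := orderOf_dvd_of_pow_eq_one hzn
  obtain ⟨f, hf⟩ : ∃ f, f = orderOf z := ⟨_, rfl⟩
  rw [← hf] at hfn
  have hf0 : f ≠ 0 := ne_zero_of_dvd_ne_zero P.n₂_ne hfn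
  have hgpos : 0 < Nat.gcd f D₂ := Nat.gcd_pos_of_pos_left _ (Nat.pos_of_ne_zero hf0)
  -- With `f = ord(z)`, `v = f / gcd(f, D₂)` is the least positive exponent making `z ^ v` a `D₂`-th
  -- root of unity, hence a power of `ζ₂`.
  obtain ⟨v, hv⟩ := Nat.gcd_dvd_left f D₂
  have hvn : v ∣ n₂ / D₂ := by
    rw [Nat.dvd_div_iff_mul_dvd P.D₂_dvd]
    have h1 : f * D₂ ∣ n₂ * Nat.gcd f D₂ := by
      rw [← Nat.gcd_mul_left]
      refine Nat.dvd_gcd ?_ ?_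
      · rw [mul_comm n₂]; exact Nat.mul_dvd_mul_left _ P.D₂_dvd
      · exact Nat.mul_dvd_mul_right hfn _
    have h2 : f * D₂ = D₂ * v * Nat.gcd f D₂ := by
      conv_lhs => rw [hv]
      ring
    rw [h2] at h1
    exact Nat.dvd_of_mul_dvd_mul_right hgpos h1
  have hv0 : v ≠ 0 := by
    rintro rfl
    exact hf0 (by simpa using hv)
  have hvf : v ∣ f := ⟨Nat.gcd f D₂, by rw [mul_comm]; exact hv⟩
  have hordv : orderOf (z ^ v) = Nat.gcd f D₂ := by
    rw [orderOf_pow_of_dvd hv0 (hf ▸ hvf), ← hf]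
    exact Nat.div_eq_of_eq_mul_left (Nat.pos_of_ne_zero hv0) hv
  have hζ₂ι := hζ₂.map_of_injective hinj
  obtain ⟨l, hl, hzl⟩ : ∃ l < D₂, ι ζ₂ ^ l = z ^ v := by
    apply hζ₂ι.eq_pow_of_pow_eq_one
    rw [← orderOf_dvd_iff_pow_eq_one, hordv]
    exact Nat.gcd_dvd_right _ _
  have hlv : Nat.Coprime l v := P.coprime_of_gcd_eq hv hvn (by
    rw [← orderOf_pow_of_isPrimitiveRoot P.D₂_ne hζ₂ι, hzl, hordv])
  refine ⟨k, hkD, v, hvn, l, hl, hlv, ?_⟩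
  rw [pow_mul, ← hy, ← hg, map_mul, map_pow, hzl, hz, div_pow, pow_mul g, map_pow ι _ v,
    div_mul_cancel₀]
  exact pow_ne_zero _ hz0

/-- The congruences `u ≡ μ - m (mod τ)` and `u ≡ κ (mod σ)` are compatible exactly when `m ≡ μ - κ`
modulo the gcd. To stay in `ℕ`, `-κ` becomes `κ (gcd - 1)` and `-m` becomes `m (τ - 1)`. -/
theorem exists_add_modEq_and_modEq {τ σ : ℕ} (hτ : 0 < τ) (hσ : 0 < σ) (μ κ : ℕ) :
    ∃ m < Nat.gcd τ σ, ∃ u < Nat.lcm τ σ, m + u ≡ μ [MOD τ] ∧ u ≡ κ [MOD σ] := by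
  have hG : 0 < Nat.gcd τ σ := Nat.gcd_pos_of_pos_left _ hτ
  obtain ⟨G, hGe⟩ : ∃ G, Nat.gcd τ σ = G + 1 := ⟨_, (Nat.sub_add_cancel hG).symm⟩
  obtain ⟨τ', hτ'⟩ : ∃ τ', τ = τ' + 1 := ⟨_, (Nat.sub_add_cancel hτ).symm⟩
  set m := (μ + κ * G) % Nat.gcd τ σ with hm
  have hmκ : m + κ ≡ μ [MOD Nat.gcd τ σ] := by
    refine ((Nat.mod_modEq _ _).add_right κ).trans ?_
    rw [show μ + κ * G + κ = μ + κ * (G + 1) by ring, ← hGe]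
    simp [Nat.ModEq]
  have hcomp : μ + m * τ' ≡ κ [MOD Nat.gcd τ σ] := by
    refine Nat.ModEq.add_left_cancel' m (Nat.ModEq.trans ?_ hmκ.symm)
    rw [show m + (μ + m * τ') = μ + m * (τ' + 1) by ring, ← hτ']
    refine Nat.ModEq.of_dvd (Nat.gcd_dvd_left τ σ) ?_
    simp [Nat.ModEq]
  obtain ⟨u, hu₁, hu₂⟩ := Nat.chineseRemainder' hcomp
  refine ⟨m, Nat.mod_lt _ hG, u % Nat.lcm τ σ, Nat.mod_lt _ (Nat.lcm_pos hτ hσ), ?_, ?_⟩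
  · have h1 : u % Nat.lcm τ σ ≡ μ + m * τ' [MOD τ] :=
      ((Nat.mod_modEq _ _).of_dvd (Nat.dvd_lcm_left _ _)).trans hu₁
    refine (h1.add_left m).trans ?_
    rw [show m + (μ + m * τ') = μ + m * (τ' + 1) by ring, ← hτ']
    simp [Nat.ModEq]
  · exact ((Nat.mod_modEq _ _).of_dvd (Nat.dvd_lcm_right _ _)).trans hu₂

/-- The constants of the binomials over the extension field are conjugate to those given by
the systems of representatives. -/
theorem Params.exists_eq_rootConst_pow (P : Params q (orderOf a) n₁ n₂ D₁ D₂ s s₁ r t)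
    [Fintype F] (hq : Fintype.card F = q) (hL : Module.finrank F L = s)
    (hb : b ^ D₁ = algebraMap F L a) (hζ₁ : IsPrimitiveRoot ζ₁ D₁)
    (hζ₂ : IsPrimitiveRoot ζ₂ D₂) {J I : Finset ℕ}
    (hJ : IsRepSystem (FrobRel q s₁ ζ₁ b) D₁ J) (hI : IsCyclotomicRepSystem q D₂ I)
    {k v l : ℕ} (hk : k < D₁) (hvn : v ∣ n₂ / D₂) (hl : l < D₂) (hlv : Nat.Coprime l v) :
    ∃ j ∈ J, ∃ i ∈ I, Nat.Coprime i v ∧ ∃ m < Nat.gcd (t i) s₁, ∃ u < Nat.lcm (t i) s₁,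
        ζ₂ ^ l * (ζ₁ ^ k * b) ^ (r * v) = rootConst q r ζ₁ ζ₂ b j v i m ^ q ^ u := by
  subst hq
  obtain ⟨j, ⟨hj, hkj⟩, -⟩ := hJ.2 k hk
  obtain ⟨i, ⟨hi, hli⟩, -⟩ := hI.2 l hl
  have hiD := Finset.mem_range.1 (hI.1 hi)
  obtain ⟨m₁, hm₁⟩ := (P.frobRel_iff rfl hb hζ₁ _ _).1 hkj
  obtain ⟨m₂, hm₂⟩ := (mem_cyclotomicCoset_iff hζ₂ hiD).1 hli
  obtain ⟨κ, hκ⟩ := exists_eq_pow_card_pow (F := F) hL P.s_pos (x := ζ₁ ^ k * b)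
    (y := ζ₁ ^ j * b) (k := m₁) (l := 0) (by rw [hm₁]; simp)
  obtain ⟨μ, hμ⟩ := exists_eq_pow_card_pow (F := F) hL P.s_pos (x := ζ₂ ^ l)
    (y := ζ₂ ^ i) (k := m₂) (l := 0) (by rw [hm₂]; simp)
  -- As `i = l q ^ w mod D₂`, a prime of `v`, which divides `D₂` but not `q`, divides `i` only if it
  -- divides `l`.
  have hiv : Nat.Coprime i v := by
    obtain ⟨w, hw⟩ := hli
    refine Nat.coprime_of_dvd fun p hp hpi hpv => ?_
    have hpn := hpv.trans (hvn.trans (Nat.div_dvd_of_dvd P.D₂_dvd))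
    rw [hw, Nat.dvd_mod_iff (P.dvd_D₂ p hp hpn)] at hpi
    rcases hp.dvd_mul.1 hpi with h | h
    · exact Nat.not_coprime_of_dvd_of_dvd hp.one_lt h hpv hlv
    · exact Nat.not_coprime_of_dvd_of_dvd hp.one_lt hpn (hp.dvd_of_dvd_pow h) P.coprime_q
  obtain ⟨m, hm, u, hu, h1, h2⟩ := exists_add_modEq_and_modEq (P.t_pos i) P.s₁_pos μ κ
  refine ⟨j, hj, i, hi, hiv, m, hm, u, hu, ?_⟩
  have e1 := (pow_card_pow_eq_iff_modEq (F := F)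
    (P.root_of_unity_pow_pow_eq_self_iff hζ₂ i) _ _).2 h1
  have e2 := (pow_card_pow_eq_iff_modEq (F := F) (P.root_pow_pow_eq_self_iff hb hζ₁ j) _ _).2 h2
  rw [rootConst, mul_pow (ζ₂ ^ _), ← pow_mul, mul_assoc, ← pow_add, pow_mul ζ₂ i, e1, ← hμ,
    ← pow_mul, mul_comm (r * v), pow_mul (ζ₁ ^ j * b) (_ ^ u), e2, ← hκ]

end Factors

/-! ### The factorization -/

theorem dvd_of_forall_root {F : Type*} [Field F] (Ω : Type*) [Field Ω] [Algebra F Ω]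
    [IsAlgClosed Ω] {f g : F[X]} (hf : f.Separable) (hg : g ≠ 0)
    (h : ∀ x : Ω, aeval x f = 0 → aeval x g = 0) : f ∣ g := by
  rw [← map_dvd_map' (algebraMap F Ω)]
  have hgΩ : g.map (algebraMap F Ω) ≠ 0 :=
    (Polynomial.map_ne_zero_iff (algebraMap F Ω).injective).2 hg
  have hfΩ : f.map (algebraMap F Ω) ≠ 0 :=
    (Polynomial.map_ne_zero_iff (algebraMap F Ω).injective).2 hf.ne_zero
  refine (IsAlgClosed.splits _).dvd_of_roots_le_roots hfΩ ?_
  rw [Multiset.le_iff_subset (nodup_roots hf.map)]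
  intro x hx
  rw [mem_roots hfΩ, IsRoot, eval_map_algebraMap] at hx
  rw [mem_roots hgΩ, IsRoot, eval_map_algebraMap]
  exact h x hx

theorem natCast_ne_zero_of_coprime_card {F : Type*} [Field F] [Fintype F] {n : ℕ}
    (h : Nat.Coprime n (Fintype.card F)) : (n : F) ≠ 0 := by
  obtain ⟨p, hp⟩ := CharP.exists F
  have hprime : p.Prime := (CharP.char_is_prime_or_zero F p).resolve_right
    (CharP.char_ne_zero_of_finite F p)
  rw [Ne, CharP.cast_eq_zero_iff F p]
  intro hpn
  refine Nat.not_coprime_of_dvd_of_dvd hprime.one_lt hpn ?_ h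
  rw [← CharP.cast_eq_zero_iff F p]
  exact Nat.cast_card_eq_zero F

theorem Params.exists_factorization {F : Type*} [Field F] [Fintype F] {L : Type*} [Field L]
    [Algebra F L] {q n₁ n₂ D₁ D₂ s s₁ r : ℕ} {t : ℕ → ℕ} {a : F} {b ζ₁ ζ₂ : L} (ha : a ≠ 0)
    (P : Params q (orderOf a) n₁ n₂ D₁ D₂ s s₁ r t)
    (hq : Fintype.card F = q) (hn : Nat.Coprime (n₁ * n₂) q) (hL : Module.finrank F L = s)
    (hb : b ^ D₁ = algebraMap F L a) (hζ₁ : IsPrimitiveRoot ζ₁ D₁)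
    (hζ₂ : IsPrimitiveRoot ζ₂ D₂) {J I : Finset ℕ}
    (hJ : IsRepSystem (FrobRel q s₁ ζ₁ b) D₁ J) (hI : IsCyclotomicRepSystem q D₂ I) :
    ∃ S : ℕ → ℕ → ℕ → ℕ → F[X],
      (∀ j v i m, v ∣ n₂ / D₂ → Nat.Coprime i v →
        (S j v i m).map (algebraMap F L) =
          twistProd q (n₁ / D₁ * v) (Nat.lcm (t i) s₁) (rootConst q r ζ₁ ζ₂ b j v i m) ∧
        (S j v i m).Monic ∧ Irreducible (S j v i m) ∧
        (S j v i m).natDegree = n₁ / D₁ * v * Nat.lcm (t i) s₁ ∧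
        HasOrder (S j v i m) (orderOf a * n₁ * v * (D₂ / Nat.gcd i D₂))) ∧
      X ^ (n₁ * n₂) - C a =
        ∏ j ∈ J, ∏ v ∈ (n₂ / D₂).divisors, ∏ i ∈ I with Nat.Coprime i v,
          ∏ m ∈ Finset.range (Nat.gcd (t i) s₁), S j v i m := by
  have hex : ∀ j v i m, ∃ S : F[X], v ∣ n₂ / D₂ → Nat.Coprime i v →
      S.map (algebraMap F L) =
        twistProd q (n₁ / D₁ * v) (Nat.lcm (t i) s₁) (rootConst q r ζ₁ ζ₂ b j v i m) ∧
      S.Monic ∧ Irreducible S ∧ S.natDegree = n₁ / D₁ * v * Nat.lcm (t i) s₁ ∧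
      HasOrder S (orderOf a * n₁ * v * (D₂ / Nat.gcd i D₂)) ∧ S ∣ X ^ (n₁ * n₂) - C a := by
    intro j v i m
    by_cases h : v ∣ n₂ / D₂ ∧ Nat.Coprime i v
    · obtain ⟨S, hS⟩ := P.exists_factor hq hb hζ₁ hζ₂ (j := j) (m := m) h.1 h.2
      exact ⟨S, fun _ _ => hS⟩
    · exact ⟨0, fun h1 h2 => absurd ⟨h1, h2⟩ h⟩
  choose S hS using hex
  refine ⟨S, fun j v i m hv hiv => ?_, ?_⟩
  · obtain ⟨h1, h2, h3, h4, h5, -⟩ := hS j v i m hv hiv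
    exact ⟨h1, h2, h3, h4, h5⟩
  have hnF : ((n₁ * n₂ : ℕ) : F) ≠ 0 := natCast_ne_zero_of_coprime_card (hq ▸ hn)
  have hn0 : n₁ * n₂ ≠ 0 := mul_ne_zero P.n₁_ne P.n₂_ne
  let K : Finset (Σ _ : ℕ, Σ _ : ℕ, Σ _ : ℕ, ℕ) :=
    J.sigma fun _ => (n₂ / D₂).divisors.sigma fun v =>
      (I.filter fun i => Nat.Coprime i v).sigma fun i => Finset.range (Nat.gcd (t i) s₁)
  let T : (Σ _ : ℕ, Σ _ : ℕ, Σ _ : ℕ, ℕ) → F[X] := fun x => S x.1 x.2.1 x.2.2.1 x.2.2.2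
  have hprod : ∏ j ∈ J, ∏ v ∈ (n₂ / D₂).divisors, ∏ i ∈ I with Nat.Coprime i v,
      ∏ m ∈ Finset.range (Nat.gcd (t i) s₁), S j v i m = ∏ x ∈ K, T x := by
    simp only [K, T, Finset.prod_sigma]
  have hK : ∀ j v i m, (⟨j, v, i, m⟩ : Σ _ : ℕ, Σ _ : ℕ, Σ _ : ℕ, ℕ) ∈ K ↔
      j ∈ J ∧ v ∣ n₂ / D₂ ∧ (i ∈ I ∧ Nat.Coprime i v) ∧ m < Nat.gcd (t i) s₁ := by
    intro j v i m
    have h0 : n₂ / D₂ ≠ 0 := (Nat.div_pos (Nat.le_of_dvd (Nat.pos_of_ne_zero P.n₂_ne) P.D₂_dvd)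
      (Nat.pos_of_ne_zero P.D₂_ne)).ne'
    simp [K, h0, Finset.mem_sigma, -Nat.div_eq_zero_iff]
  rw [hprod]
  have hTmonic : ∀ x ∈ K, (T x).Monic := by
    rintro ⟨j, v, i, m⟩ hx
    obtain ⟨-, hv, ⟨-, hiv⟩, -⟩ := (hK j v i m).1 hx
    exact (hS j v i m hv hiv).2.1
  have hmonic : (∏ x ∈ K, T x).Monic := monic_prod_of_monic _ _ hTmonic
  have hsep : (X ^ (n₁ * n₂) - C a : F[X]).Separable := separable_X_pow_sub_C a hnF ha
  refine eq_of_monic_of_associated (monic_X_pow_sub_C a hn0) hmonic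
    (associated_of_dvd_dvd ?_ ?_)
  · refine dvd_of_forall_root (AlgebraicClosure L) hsep hmonic.ne_zero fun x hx => ?_
    have hx' : x ^ (n₁ * n₂) = algebraMap F (AlgebraicClosure L) a := by
      simpa [sub_eq_zero] using hx
    obtain ⟨k, hk, v, hv, l, hl, hlv, hxk⟩ := P.exists_pow_eq hb hζ₁ hζ₂ hx'
    obtain ⟨j, hj, i, hi, hiv, m, hm, u, hu, hβ⟩ :=
      P.exists_eq_rootConst_pow hq hL hb hζ₁ hζ₂ hJ hI hk hv hl hlv
    rw [map_prod]
    refine Finset.prod_eq_zero ((hK j v i m).2 ⟨hj, hv, ⟨hi, hiv⟩, hm⟩) ?_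
    change aeval x (S j v i m) = 0
    rw [← aeval_map_algebraMap L, (hS j v i m hv hiv).1, twistProd, map_prod]
    refine Finset.prod_eq_zero (Finset.mem_range.2 hu) ?_
    simp only [map_sub, map_pow, aeval_X, aeval_C]
    rw [hxk, hβ, map_pow, sub_self]
  · refine Finset.prod_dvd_of_coprime ?_ ?_
    · rintro ⟨j, v, i, m⟩ hx ⟨j', v', i', m'⟩ hx' hne
      obtain ⟨hj, hv, ⟨hi, hiv⟩, hm⟩ := (hK j v i m).1 hx
      obtain ⟨hj', hv', ⟨hi', hiv'⟩, hm'⟩ := (hK j' v' i' m').1 hx'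
      obtain ⟨h1, h2, h3, -, h5, -⟩ := hS j v i m hv hiv
      obtain ⟨h1', h2', h3', -, h5', -⟩ := hS j' v' i' m' hv' hiv'
      change IsCoprime (S j v i m) (S j' v' i' m')
      rw [h3.coprime_iff_not_dvd]
      intro hdvd
      have heq : S j v i m = S j' v' i' m' :=
        eq_of_monic_of_associated h2 h2' (h3.associated_of_dvd h3' hdvd)
      rw [heq] at h1 h5
      have hord := h5.unique h5'
      have hvv : v = v' := by
        refine eq_of_mul_div_gcd_eq P.D₂_ne hiv hiv' ?_
        rw [mul_assoc, mul_assoc _ v'] at hord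
        exact Nat.eq_of_mul_eq_mul_left
          (Nat.pos_of_ne_zero (mul_ne_zero P.e_ne P.n₁_ne)) hord
      subst hvv
      obtain ⟨u, hu⟩ := exists_eq_pow_of_twistProd_eq (P.exponent_ne hv)
        (Nat.lcm_pos (P.t_pos i) P.s₁_pos) (h1.symm.trans h1')
      obtain ⟨rfl, rfl, rfl⟩ :=
        P.eq_of_rootConst_eq hq hL hb hζ₁ hζ₂ hJ hI hv hj hj' hi hi' hm hm' hu
      exact hne rfl
    · rintro ⟨j, v, i, m⟩ hx
      obtain ⟨-, hv, ⟨-, hiv⟩, -⟩ := (hK j v i m).1 hx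
      exact (hS j v i m hv hiv).2.2.2.2.2

/-! ### Verification of the parameters -/

theorem orderOf_dvd_card_sub_one {F : Type*} [Field F] [Fintype F] {a : F} (ha : a ≠ 0) :
    orderOf a ∣ Fintype.card F - 1 :=
  orderOf_dvd_of_pow_eq_one (FiniteField.pow_card_sub_one_eq_one a ha)

theorem prime_dvd_of_radical_dvd {n e p : ℕ} (hn : n ≠ 0)
    (h : UniqueFactorizationMonoid.radical n ∣ e) (hp : p.Prime) (hpn : p ∣ n) : p ∣ e :=
  ((UniqueFactorizationMonoid.dvd_radical_iff_of_irreducible hp hn).2 hpn).trans h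

theorem mul_dOne_dvd {q e n₁ : ℕ} (he : e ∣ q - 1) (s : ℕ) : e * dOne q e n₁ s ∣ q ^ s - 1 := by
  have hes : e ∣ q ^ s - 1 := he.trans (by
    simpa using pow_sub_one_dvd_pow_sub_one (q := q) (one_dvd s))
  exact (Nat.dvd_div_iff_mul_dvd hes).1 (Nat.gcd_dvd_right _ _)

theorem params_of_order {q e n₁ n₂ r : ℕ} (hq : 1 < q) (hn : Nat.Coprime (n₁ * n₂) q)
    (hn₁0 : n₁ ≠ 0) (hn₂0 : n₂ ≠ 0) (he : e ∣ q - 1)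
    (hn₁ : UniqueFactorizationMonoid.radical n₁ ∣ e) (hn₂ : Nat.Coprime n₂ e)
    (hr : r * n₂ ≡ 1 [MOD e * dOne q e n₁ (extDegree q (n₁ * n₂))]) :
    Params q e n₁ n₂ (dOne q e n₁ (extDegree q (n₁ * n₂))) (dTwo q n₂ (extDegree q (n₁ * n₂)))
      (extDegree q (n₁ * n₂)) (sOne q e n₁ (extDegree q (n₁ * n₂))) r
      (tMin q n₂ (extDegree q (n₁ * n₂))) := by
  have hq0 : 0 < q := by omega
  have he0 : e ≠ 0 := by
    rintro rfl
    rw [zero_dvd_iff] at he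
    omega
  have hrad : ∀ p, p.Prime → p ∣ n₁ → p ∣ e := fun p hp => prime_dvd_of_radical_dvd hn₁0 hn₁ hp
  have hn₂q : Nat.Coprime n₂ q := hn.coprime_dvd_left (dvd_mul_left _ _)
  exact
    { one_lt_q := hq
      e_ne := he0
      n₁_ne := hn₁0
      n₂_ne := hn₂0
      s_pos := extDegree_pos hn
      coprime_q := hn₂q
      dvd_e := hrad
      coprime_e := hn₂
      dvd_D₂ := fun p hp hpn => Nat.dvd_gcd hpn
        (prime_dvd_pow_extDegree_sub_one hq0 (mul_ne_zero hn₁0 hn₂0) hp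
          (hpn.trans (dvd_mul_left _ _)))
      D₁_dvd := Nat.gcd_dvd_left _ _
      D₂_dvd := Nat.gcd_dvd_left _ _
      mul_D₁_dvd := mul_dOne_dvd he _
      D₂_dvd_pow := Nat.gcd_dvd_right _ _
      coprime_D₁ := by
        rw [← Nat.div_div_eq_div_mul]
        exact Nat.coprime_div_gcd_div_gcd (Nat.gcd_pos_of_pos_left _ (Nat.pos_of_ne_zero hn₁0))
      coprime_D₂ :=
        Nat.coprime_div_gcd_div_gcd (Nat.gcd_pos_of_pos_left _ (Nat.pos_of_ne_zero hn₂0))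
      four_dvd := four_dvd_pow_extDegree_sub_one hn
      dvd_iff_s₁ := mul_dOne_dvd_pow_sub_one_iff_sOne_dvd hq hn₁0 (dvd_mul_right _ _) hn he hrad
      dvd_iff_t := fun i => dvd_pow_sub_one_iff_tMin_dvd hq0 hn₂0 hn₂q
      r_modEq := hr }

/-! ### Roots of unity and roots of `a` in the extension field -/

section Existence

variable {L : Type*} [Field L] [Finite L] {D : ℕ}

theorem exists_isPrimitiveRoot_of_dvd_card_sub_one (hD : D ∣ Nat.card L - 1) :
    ∃ ζ : L, IsPrimitiveRoot ζ D := by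
  obtain ⟨g, hg⟩ := IsCyclic.exists_ofOrder_eq_natCard (α := Lˣ)
  rw [Nat.card_units] at hg
  obtain ⟨k, hk⟩ := hD
  have hpos : 0 < Nat.card L - 1 := hg ▸ orderOf_pos g
  have hprim : IsPrimitiveRoot (g : L) (Nat.card L - 1) := by
    rw [← hg, ← orderOf_units]
    exact IsPrimitiveRoot.orderOf _
  exact ⟨_, hprim.pow hpos (by rw [hk, mul_comm])⟩

/-- With `a = g ^ k` for a generator `g`, the group order divides `k ord(a)`; it is itself a
multiple of `ord(a) D`, so `D ∣ k`. -/
theorem exists_pow_eq_of_mul_orderOf_dvd {a : L} (ha : a ≠ 0)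
    (hD : orderOf a * D ∣ Nat.card L - 1) : ∃ b : L, b ^ D = a := by
  obtain ⟨g, hg⟩ := IsCyclic.exists_generator (α := Lˣ)
  have hord : orderOf g = Nat.card L - 1 := by
    rw [orderOf_eq_card_of_forall_mem_zpowers hg, Nat.card_units]
  obtain ⟨k, hk⟩ := mem_powers_iff_mem_zpowers.2 (hg (Units.mk0 a ha))
  have hk' : g ^ k = Units.mk0 a ha := hk
  have hak : orderOf a = orderOf (g ^ k) := by rw [hk', ← orderOf_units]; rfl
  have hdvd : D ∣ k := by
    have h1 : (g ^ k) ^ orderOf a = 1 := by rw [hak]; exact pow_orderOf_eq_one _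
    rw [← pow_mul, ← orderOf_dvd_iff_pow_eq_one, hord] at h1
    have h2 := hD.trans h1
    rw [mul_comm k] at h2
    refine Nat.dvd_of_mul_dvd_mul_left ?_ h2
    rw [hak]
    exact orderOf_pos _
  obtain ⟨l, rfl⟩ := hdvd
  refine ⟨(g ^ l : Lˣ), ?_⟩
  rw [← Units.val_pow_eq_pow_val, ← pow_mul, mul_comm, hk']
  rfl

end Existence

end BinomialFactorization

theorem theorem18 {F : Type*} [Field F] [Fintype F] (q : ℕ) (hq : Fintype.card F = q)
    (a : F) (ha : a ≠ 0) (n n₁ n₂ : ℕ) (hnq : Nat.Coprime n q) (hn : n = n₁ * n₂)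
    (hn₁ : UniqueFactorizationMonoid.radical n₁ ∣ orderOf a)
    (hn₂ : Nat.Coprime n₂ (orderOf a))
    (s : ℕ) (hs : s = extDegree q n)
    (D₁ D₂ : ℕ) (hD₁ : D₁ = dOne q (orderOf a) n₁ s) (hD₂ : D₂ = dTwo q n₂ s)
    (s₁ : ℕ) (hs₁ : s₁ = sOne q (orderOf a) n₁ s)
    (t c : ℕ → ℕ) (ht : ∀ i, t i = tMin q n₂ s i)
    (hc : ∀ i, c i = cDegree q (orderOf a) n₁ n₂ s i)
    -- `L` is the field with `q ^ s` elements
    {L : Type*} [Field L] [Algebra F L] (hL : Module.finrank F L = s) :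
    (∃ b : L, b ^ D₁ = algebraMap F L a) ∧
    (∃ ζ₁ : L, IsPrimitiveRoot ζ₁ D₁) ∧ (∃ ζ₂ : L, IsPrimitiveRoot ζ₂ D₂) ∧
    ∀ (b ζ₁ ζ₂ : L), b ^ D₁ = algebraMap F L a →
      IsPrimitiveRoot ζ₁ D₁ → IsPrimitiveRoot ζ₂ D₂ →
      Equivalence (fun j k : Fin D₁ => FrobRel q s₁ ζ₁ b j k) ∧
      ∀ r : ℕ, 0 < r → (a = 1 → r = 1) → (a ≠ 1 → r * n₂ ≡ 1 [MOD orderOf a * D₁]) →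
      ∀ J I : Finset ℕ, IsRepSystem (FrobRel q s₁ ζ₁ b) D₁ J → IsCyclotomicRepSystem q D₂ I →
      ∃ S : ℕ → ℕ → ℕ → ℕ → F[X],
        (∀ j ∈ J, ∀ v ∈ (n₂ / D₂).divisors, ∀ i ∈ I, Nat.Coprime i v →
          ∀ m < Nat.gcd (t i) s₁,
            (S j v i m).map (algebraMap F L) =
              explicitFactor q (n₁ / D₁ * v) (c i) (rootConst q r ζ₁ ζ₂ b j v i m) ∧
            (S j v i m).map (algebraMap F L) =
              qSpin F (X ^ (n₁ / D₁ * v) - C (rootConst q r ζ₁ ζ₂ b j v i m)) ∧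
            (S j v i m).Monic ∧ Irreducible (S j v i m) ∧
            (S j v i m).natDegree = n₁ / D₁ * v * c i ∧
            HasOrder (S j v i m) (orderOf a * n₁ * v * (D₂ / Nat.gcd i D₂))) ∧
        X ^ n - C a =
          ∏ j ∈ J, ∏ v ∈ (n₂ / D₂).divisors, ∏ i ∈ I with Nat.Coprime i v,
            ∏ m ∈ Finset.range (Nat.gcd (t i) s₁), S j v i m := by
  obtain rfl : t = tMin q n₂ s := funext ht
  obtain rfl : c = fun i => Nat.lcm (tMin q n₂ s i) s₁ :=
    funext fun i => by rw [hc, cDegree, hs₁]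
  have hq1 : 1 < q := hq ▸ Fintype.one_lt_card
  have hn0 : n₁ * n₂ ≠ 0 := by
    intro h
    rw [hn, h, Nat.coprime_zero_left] at hnq
    omega
  obtain ⟨hn₁0, hn₂0⟩ := mul_ne_zero_iff.1 hn0
  have he : orderOf a ∣ q - 1 := hq ▸ orderOf_dvd_card_sub_one ha
  have he0 : 0 < orderOf a := Nat.pos_of_dvd_of_pos he (by omega)
  subst hn
  have hs0 : 0 < s := hs ▸ extDegree_pos hnq
  have : FiniteDimensional F L := FiniteDimensional.of_finrank_pos (hL ▸ hs0)
  have : Finite L := Module.finite_of_finite F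
  have hcard : Nat.card L = q ^ s := by
    have := Fintype.ofFinite L
    rw [Nat.card_eq_fintype_card, Module.card_eq_pow_finrank (K := F), hq, hL]
  have hD₁s : orderOf a * D₁ ∣ Nat.card L - 1 := by
    rw [hcard, hD₁]
    exact mul_dOne_dvd he s
  have hD₂s : D₂ ∣ Nat.card L - 1 := by
    rw [hcard, hD₂]
    exact Nat.gcd_dvd_right _ _
  have hparams : ∀ r, r * n₂ ≡ 1 [MOD orderOf a * D₁] →
      Params q (orderOf a) n₁ n₂ D₁ D₂ s s₁ r (tMin q n₂ s) := by
    intro r hr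
    subst hs hD₁ hD₂ hs₁
    exact params_of_order hq1 hnq hn₁0 hn₂0 he hn₁ hn₂ hr
  refine ⟨exists_pow_eq_of_mul_orderOf_dvd ((_root_.map_ne_zero _).2 ha)
      (by rwa [orderOf_algebraMap]),
    exists_isPrimitiveRoot_of_dvd_card_sub_one ((dvd_mul_left _ _).trans hD₁s),
    exists_isPrimitiveRoot_of_dvd_card_sub_one hD₂s, fun b ζ₁ ζ₂ hb hζ₁ hζ₂ => ⟨?_, ?_⟩⟩
  · have hD₁n : D₁ ∣ n₁ := hD₁ ▸ Nat.gcd_dvd_left _ _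
    -- The equivalence claim involves no `r`, but `Params` requires one; any inverse of `n₂` will
    -- do.
    obtain ⟨r, hr⟩ := exists_mul_modEq_one
      (Nat.mul_pos he0 (Nat.pos_of_ne_zero (ne_zero_of_dvd_ne_zero hn₁0 hD₁n)))
      (coprime_mul_of_prime_dvd hn₂ fun p hp h =>
        prime_dvd_of_radical_dvd hn₁0 hn₁ hp (h.trans hD₁n))
    exact (hparams r hr).equivalence_frobRel hq hL hb hζ₁
  · intro r _ hr1 hr J I hJ hI
    have hrmod : r * n₂ ≡ 1 [MOD orderOf a * D₁] := by
      -- For `a = 1` the radical condition forces `n₁ = D₁ = 1`, so the modulus is `1` and the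
      -- congruence is automatic.
      by_cases ha1 : a = 1
      · have hn₁1 : n₁ = 1 := by
          rw [ha1, orderOf_one, Nat.dvd_one, Nat.radical_eq_one_iff] at hn₁
          omega
        have : D₁ = 1 := by rw [hD₁, hn₁1, dOne, Nat.gcd_one_left]
        rw [this, ha1, orderOf_one]
        exact Nat.modEq_one
      · exact hr ha1
    have P := hparams r hrmod
    obtain ⟨S, hS, hprod⟩ := P.exists_factorization ha hq hnq hL hb hζ₁ hζ₂ hJ hI
    refine ⟨S, fun j _ v hv i _ hiv m _ => ?_, hprod⟩
    have hv := Nat.dvd_of_mem_divisors hv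
    obtain ⟨h1, h2, h3, h4, h5⟩ := hS j v i m hv hiv
    refine ⟨by rw [h1, explicitFactor_eq_twistProd], ?_, h2, h3, h4, h5⟩
    subst hq
    rw [h1, qSpin_X_pow_sub_C_eq_twistProd (P.exponent_ne hv)
      (Nat.lcm_pos (P.t_pos i) P.s₁_pos)
      (P.rootConst_pow_pow_eq_self_iff hb hζ₁ hζ₂ hv j i m)]
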